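/- Let $m=(m_0,m_1,\dots)$ be a bounded sequence of integers $m_k\ge 2$, let $G_m=\prod_{k\ge0}\mathbb Z/m_k\mathbb Z$ be the corresponding bounded Vilenkin group with normalized Haar measure $\mu$ (the product of the uniform measures), and put $M_0=1$, $M_{k+1}=m_kM_k$. Every integer $n\ge 1$ is uniquely $n=\sum_j n_jM_j$ with $0\le n_j<m_j$; let $\langle n\rangle$ and $|n|$ be the least and the greatest $j$ with $n_j\ne0$, and $\rho(n)=|n|-\langle n\rangle$ (all three are set to $0$ for $n=0$). Let $\psi_n(x)=\prod_k \exp(2\pi i\,n_kx_k/m_k)$ be the Vilenkin system. Let $\mathcal F_n$ be the $\sigma$-algebra generated by the sets $I_n(x)=\{y\in G_m: y_0=x_0,\dots,y_{n-1}=x_{n-1}\}$. For a complex-valued martingale $f=(f_n)_{n\ge 0}$ with respect to $(\mathcal F_n)$ put $\|f\|_{H_p}=\big(\int_{G_m}\sup_n|f_n|^p\,d\mu\big)^{1/p}$, let $H_p$ be the set of such $f$ with $\|f\|_{H_p}<\infty$, and let $S_nf=\sum_{i<n}\widehat f(i)\psi_i$ with $\widehat f(i)=\lim_{k\to\infty}\int_{G_m}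 f_k\overline{\psi_i}\,d\mu$. For an integrable function $g$, $\|g\|_{H_p}$ is the $H_p$-norm of the martingale $(S_{M_k}g)_k$, and for a measurable function $g$, $\|g\|_{L_{p,\infty}}=\sup_{t>0}t\,\mu(|g|>t)^{1/p}$. Let $0<p<1$. (a) There is a constant $c_p>0$, depending only on $p$ and on an upper bound for the sequence $m$, such that for all $f\in H_p$ and all integers $n\ge1$, $$\|S_nf\|_{H_p}\le c_p\Big(\frac{M_{|n|}}{M_{\langle n\rangle}}\Big)^{1/p-1}\|f\|_{H_p}.$$ (b) Let $(n_k)_{k\ge 0}$ be a (strictly) increasing sequence of nonnegative integers with $\sup_k\rho(n_k)=\infty$, and let $(\Phi_n)_{n\ge 0}$ be any non-decreasing sequence of real numbers with $$\limsup_{k\to\infty}\frac{1}{\Phi_{n_k}}\Big(\frac{M_{|n_k|}}{M_{\langle n_k\rangle}}\Big)^{1/p-1}=\infty$$ (quotients with $\Phi_{n_k}=0$, of which there can be only finitely many, are read as $0$, here and below). Then there is a martingale $f\in H_p$ such that $$\sup_{k}\Big\|\frac{S_{n_k}f}{\Phi_{n_k}}\Big\|_{L_{p,\infty}}=\infty.$$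 -/

import Mathlib

open MeasureTheory ProbabilityTheory Filter Topology
open scoped ENNReal NNReal

namespace Vilenkin

/-- The Vilenkin group `G_m`: the complete direct product of the groups `Z_{m_k}`. -/
abbrev Group (m : ℕ → ℕ) : Type := ∀ k, ZMod (m k)

/-- The product measure of the uniform distributions on the `Z_{m_k}`
(the normalized Haar measure of `G_m`). -/
noncomputable def haar (m : ℕ → ℕ) : Measure (Group m) :=
  Measure.infinitePi fun k => uniformOn (Set.univ : Set (ZMod (m k)))

/-- The generalized powers `M_0 = 1`, `M_{k+1} = m_k M_k`. -/
def M (m : ℕ → ℕ) : ℕ → ℕ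
  | 0 => 1
  | k + 1 => m k * M m k

/-- The `j`-th digit `n_j` in the expansion `n = ∑ n_j M_j` with `0 ≤ n_j < m_j`. -/
def digit (m : ℕ → ℕ) (n j : ℕ) : ℕ := n / M m j % m j

/-- `⟨n⟩`, the least index of a nonzero digit of `n ≥ 1` (`0` for `n = 0`). -/
noncomputable def low (m : ℕ → ℕ) (n : ℕ) : ℕ := sInf {j | digit m n j ≠ 0}

/-- `|n|`, the greatest index of a nonzero digit of `n ≥ 1` (`0` for `n = 0`). -/
noncomputable def high (m : ℕ → ℕ) (n : ℕ) : ℕ := sSup {j | digit m n j ≠ 0}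

/-- `ρ(n) = |n| - ⟨n⟩`. -/
noncomputable def rho (m : ℕ → ℕ) (n : ℕ) : ℕ := high m n - low m n

/-- The interval `I_n(x)`. -/
def I (m : ℕ → ℕ) (n : ℕ) (x : Group m) : Set (Group m) := {y | ∀ j < n, y j = x j}

/-- The generalized Rademacher functions `r_k(x) = exp(2πi x_k / m_k)`. -/
noncomputable def rademacher (m : ℕ → ℕ) (k : ℕ) (x : Group m) : ℂ :=
  Complex.exp (2 * Real.pi * Complex.I * ((x k).val : ℂ) / (m k : ℂ))

/-- The Vilenkin functions `ψ_n = ∏_k r_k ^ n_k` (only finitely many factors differ from 1). -/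
noncomputable def psi (m : ℕ → ℕ) (n : ℕ) (x : Group m) : ℂ :=
  ∏ᶠ k, rademacher m k x ^ digit m n k

theorem measurableSet_I (m : ℕ → ℕ) (n : ℕ) (x : Group m) : MeasurableSet (I m n x) := by
  have h : I m n x = ⋂ j ∈ Finset.range n, (fun y : Group m => y j) ⁻¹' {x j} := by
    ext y; simp [I]
  rw [h]
  exact Finset.measurableSet_biInter _ fun j _ =>
    measurable_pi_apply j (measurableSet_singleton (x j))

theorem measurableSet_I_of_le {m : ℕ → ℕ} (hm : ∀ k, m k ≠ 0) {a b : ℕ} (hab : a ≤ b)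
    (x : Group m) :
    MeasurableSet[MeasurableSpace.generateFrom (Set.range (I m b))] (I m a x) := by
  have : ∀ k, NeZero (m k) := fun k => ⟨hm k⟩
  have h : I m a x = ⋃₀ (I m b '' I m a x) := by
    ext y
    simp only [Set.mem_sUnion, Set.mem_image, exists_exists_and_eq_and]
    constructor
    · exact fun hy => ⟨y, hy, fun _ _ => rfl⟩
    · rintro ⟨z, hz, hy⟩ j hj
      rw [hy j (hj.trans_le hab), hz j hj]
  have hfin : (Set.range (I m b)).Finite := by
    have hsub : Set.range (I m b) ⊆ Set.range
        fun (z : ∀ j : Fin b, ZMod (m j)) => {y : Group m | ∀ j : Fin b, y j = z j} := by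
      rintro _ ⟨z, rfl⟩
      refine ⟨fun j => z j, ?_⟩
      ext y
      exact ⟨fun h j hj => h ⟨j, hj⟩, fun h j => h j j.2⟩
    exact (Set.finite_range _).subset hsub
  rw [h]
  refine MeasurableSet.sUnion (hfin.subset (Set.image_subset_range _ _)).countable ?_
  rintro _ ⟨z, _, rfl⟩
  exact MeasurableSpace.measurableSet_generateFrom ⟨z, rfl⟩

/-- The filtration of the σ-algebras generated by the intervals `I_n(x)`, `x ∈ G_m`. -/
def filtration (m : ℕ → ℕ) (hm : ∀ k, 2 ≤ m k) :
    Filtration ℕ (inferInstance : MeasurableSpace (Group m)) where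
  seq n := MeasurableSpace.generateFrom (Set.range (I m n))
  mono' a b hab := MeasurableSpace.generateFrom_le (by
    rintro _ ⟨x, rfl⟩
    exact measurableSet_I_of_le (fun k => by have := hm k; omega) hab x)
  le' n := MeasurableSpace.generateFrom_le (by
    rintro _ ⟨x, rfl⟩
    exact measurableSet_I m n x)

/-- The (quasi-)norm `‖f‖_{H_p} = ‖f^*‖_p`, where `f^* = sup_n |f_n|`. -/
noncomputable def HpNorm (m : ℕ → ℕ) (p : ℝ) (f : ℕ → Group m → ℂ) : ℝ≥0∞ :=
  (∫⁻ x, (⨆ n, ‖f n x‖ₑ) ^ p ∂haar m) ^ (1 / p)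

/-- The martingale Hardy space `H_p(G_m)`. -/
def MemHp (m : ℕ → ℕ) (hm : ∀ k, 2 ≤ m k) (p : ℝ) (f : ℕ → Group m → ℂ) : Prop :=
  Martingale f (filtration m hm) (haar m) ∧ HpNorm m p f < ∞

/-- The `i`-th Vilenkin–Fourier coefficient of a function. -/
noncomputable def coeffFun (m : ℕ → ℕ) (g : Group m → ℂ) (i : ℕ) : ℂ :=
  ∫ x, g x * (starRingEnd ℂ) (psi m i x) ∂haar m

/-- The `n`-th partial sum of the Vilenkin–Fourier series of a function. -/
noncomputable def partialSumFun (m : ℕ → ℕ) (n : ℕ) (g : Group m → ℂ) (x : Group m) : ℂ :=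
  ∑ i ∈ Finset.range n, coeffFun m g i * psi m i x

/-- The martingale `(S_{M_k} g)_k` obtained from an integrable function `g`. -/
noncomputable def toMartingale (m : ℕ → ℕ) (g : Group m → ℂ) (k : ℕ) : Group m → ℂ :=
  partialSumFun m (M m k) g

/-- The `i`-th Vilenkin–Fourier coefficient of a martingale, `lim_k ∫ f_k conj(ψ_i) dμ`
(the sequence under the limit is eventually constant). -/
noncomputable def coeff (m : ℕ → ℕ) (f : ℕ → Group m → ℂ) (i : ℕ) : ℂ :=
  limUnder atTop fun k => coeffFun m (f k) i

/-- The `n`-th partial sum `S_n f` of the Vilenkin–Fourier series of a martingale. -/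
noncomputable def partialSum (m : ℕ → ℕ) (n : ℕ) (f : ℕ → Group m → ℂ) (x : Group m) : ℂ :=
  ∑ i ∈ Finset.range n, coeff m f i * psi m i x

/-- The weak (quasi-)norm `‖g‖_{L_{p,∞}} = sup_{t > 0} t μ(|g| > t)^{1/p}`. -/
noncomputable def weakNorm (m : ℕ → ℕ) (p : ℝ) (g : Group m → ℂ) : ℝ≥0∞ :=
  ⨆ (t : ℝ) (_ : 0 < t), ENNReal.ofReal t * haar m {x | t < ‖g x‖} ^ (1 / p)

/-- The factor `(M_{|n|} / M_{⟨n⟩})^{1/p - 1}`. -/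
noncomputable def ratio (m : ℕ → ℕ) (p : ℝ) (n : ℕ) : ℝ :=
  ((M m (high m n) : ℝ) / (M m (low m n) : ℝ)) ^ (1 / p - 1)

end Vilenkin

namespace Vilenkin

/-! ### Generalized powers and digits -/

/-! Write `a = low m n`, `b = high m n`, and let `D_n` be the Dirichlet kernel. Upper estimate.
Removing the digits of `n` one at a time splits `D_n` into one block per digit. The block of digit
`j` is supported on `I_j` and bounded by `m_j M_j`, and only `a ≤ j ≤ b` occur (`norm_kernel_le`).
Moreover `S_n f = S_n f_{b+1}`, and `f_{b+1}` is constant on intervals of rank `b+1`, so its `L_1`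
norm on `I_j(x)` is controlled by its `L_p` norm there, at the price `M_{b+1}^{1-p}`
(`rpow_lintegral_I_le`). Integrating over `x` leaves a geometric sum of `M_j^{p-1}`, dominated by `j
= a`; this yields `(M_b/M_a)^{1-p}`. The maximal function costs nothing more: `S_{M_k} S_n f` is
either `f_k` or `S_n f`. No atomic decomposition is needed. Sharpness. Take `f = ∑ w_b M_b^{1/p-1}
(D_{M_{b+1}} - D_{M_b})`. As `‖D_{M_b}‖_p^p = M_b^{p-1}`, it lies in `H_p` when `∑ w_b^p < ∞`. On
the coset of rank `a+1` with `x_a = 1` and `x_j = 0` for `j < a`, the kernel satisfies `|D_n| ≥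
M_a`, while the lower blocks of `f` contribute only `O(M_a^{1/p})`. Since the coset has measure
comparable to `1/M_a`, the weak norm of `S_n f` is at least a constant times `w_b` times `ratio m p
n`, up to a bounded error (`le_weakNorm_partialSum_lacunary`). The limsup condition allows levels to
be chosen so sparsely that geometrically decaying weights still give divergence. -/

theorem M_succ (m : ℕ → ℕ) (k : ℕ) : M m (k + 1) = m k * M m k := rfl

theorem M_pos {m : ℕ → ℕ} (hm : ∀ k, 2 ≤ m k) (k : ℕ) : 0 < M m k := by
  induction k with
  | zero => exact Nat.one_pos
  | succ k ih => exact Nat.mul_pos (by have := hm k; omega) ih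

theorem M_dvd (m : ℕ → ℕ) {a b : ℕ} (hab : a ≤ b) : M m a ∣ M m b := by
  induction b, hab using Nat.le_induction with
  | base => exact dvd_rfl
  | succ b _ ih => exact ih.mul_left _

theorem M_mono {m : ℕ → ℕ} (hm : ∀ k, 2 ≤ m k) : Monotone (M m) :=
  fun _ b hab => Nat.le_of_dvd (M_pos hm b) (M_dvd m hab)

theorem M_mul_two_pow_le {m : ℕ → ℕ} (hm : ∀ k, 2 ≤ m k) (a d : ℕ) :
    M m a * 2 ^ d ≤ M m (a + d) := by
  induction d with
  | zero => simp
  | succ d ih =>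
    rw [← add_assoc, M_succ, pow_succ, ← mul_assoc, mul_comm]
    exact Nat.mul_le_mul (hm _) ih

theorem lt_M_self {m : ℕ → ℕ} (hm : ∀ k, 2 ≤ m k) (n : ℕ) : n < M m n := by
  have := M_mul_two_pow_le hm 0 n
  simp only [M, one_mul, zero_add] at this
  exact Nat.lt_two_pow_self.trans_le this

theorem digit_lt {m : ℕ → ℕ} (hm : ∀ k, 2 ≤ m k) (n j : ℕ) : digit m n j < m j :=
  Nat.mod_lt _ (by have := hm j; omega)

theorem digit_eq_zero_of_lt {m : ℕ → ℕ} (hm : ∀ k, 2 ≤ m k) {n j i : ℕ} (h : n < M m j)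
    (hij : j ≤ i) : digit m n i = 0 := by
  rw [digit, Nat.div_eq_of_lt (h.trans_le (M_mono hm hij)), Nat.zero_mod]

theorem digit_mul_of_lt {m : ℕ → ℕ} (hm : ∀ k, 2 ≤ m k) (q : ℕ) {i j : ℕ} (h : i < j) :
    digit m (q * M m j) i = 0 := by
  obtain ⟨c, hc⟩ := M_dvd m (Nat.succ_le_of_lt h)
  have : q * M m j = M m i * (m i * (c * q)) := by rw [hc, M_succ]; ring
  rw [digit, this, Nat.mul_div_cancel_left _ (M_pos hm i), Nat.mul_mod_right]

theorem digit_mul_add {m : ℕ → ℕ} (hm : ∀ k, 2 ≤ m k) (q : ℕ) {l j : ℕ} (hl : l < M m j)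
    (i : ℕ) : digit m (q * M m j + l) i = digit m (q * M m j) i + digit m l i := by
  rcases lt_or_ge i j with h | h
  · rw [digit_mul_of_lt hm q h, zero_add]
    obtain ⟨c, hc⟩ := M_dvd m (Nat.succ_le_of_lt h)
    have : q * M m j + l = l + M m i * (m i * (c * q)) := by rw [hc, M_succ]; ring
    rw [digit, this, Nat.add_mul_div_left _ _ (M_pos hm i), Nat.add_mul_mod_self_left, digit]
  · rw [digit_eq_zero_of_lt hm hl h, add_zero, digit, digit]
    obtain ⟨c, hc⟩ := M_dvd m h
    rw [hc, ← Nat.div_div_eq_div_mul, ← Nat.div_div_eq_div_mul, mul_comm q,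
      Nat.mul_div_cancel_left _ (M_pos hm j), Nat.mul_add_div (M_pos hm j),
      Nat.div_eq_of_lt hl, add_zero]

theorem digit_mul_M {m : ℕ → ℕ} (hm : ∀ k, 2 ≤ m k) {s j : ℕ} (hs : s < m j) (i : ℕ) :
    digit m (s * M m j) i = if i = j then s else 0 := by
  rcases lt_trichotomy i j with h | h | h
  · rw [digit_mul_of_lt hm s h, if_neg h.ne]
  · subst h
    rw [if_pos rfl, digit, Nat.mul_div_cancel _ (M_pos hm i), Nat.mod_eq_of_lt hs]
  · rw [if_neg h.ne']
    refine digit_eq_zero_of_lt hm (j := j + 1) ?_ h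
    exact Nat.mul_lt_mul_of_pos_right hs (M_pos hm j)

theorem div_M_succ_mul_add_digit (m : ℕ → ℕ) (n j : ℕ) :
    n / M m (j + 1) * m j + digit m n j = n / M m j := by
  rw [digit, M_succ, mul_comm (m j), ← Nat.div_div_eq_div_mul, Nat.div_add_mod']

theorem finite_setOf_digit_ne_zero {m : ℕ → ℕ} (hm : ∀ k, 2 ≤ m k) (n : ℕ) :
    {j | digit m n j ≠ 0}.Finite :=
  (Set.finite_lt_nat n).subset fun j hj => by
    by_contra h
    exact hj (digit_eq_zero_of_lt hm (lt_M_self hm n) (not_lt.1 h))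

theorem eq_of_digit_eq {m : ℕ → ℕ} (hm : ∀ k, 2 ≤ m k) {i j : ℕ}
    (h : ∀ k, digit m i k = digit m j k) : i = j := by
  -- Downward induction on `k`, starting at `max i j`, where both quotients vanish because `n <
  -- M_n`.
  have key : ∀ d k, d + k = max i j → i / M m k = j / M m k := by
    intro d
    induction d with
    | zero =>
      intro k hk
      have h1 := lt_M_self hm k
      rw [Nat.div_eq_of_lt (by omega), Nat.div_eq_of_lt (by omega)]
    | succ d ih =>
      intro k hk
      rw [← div_M_succ_mul_add_digit m i k, ← div_M_succ_mul_add_digit m j k, ih (k + 1) (by omega), h]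
  simpa [M] using key _ 0 rfl

theorem exists_digit_ne_zero {m : ℕ → ℕ} (hm : ∀ k, 2 ≤ m k) {n : ℕ} (hn : 1 ≤ n) :
    {j | digit m n j ≠ 0}.Nonempty := by
  by_contra h
  have h0 : ∀ k, digit m n k = digit m 0 k := fun k => by
    have : k ∉ {j | digit m n j ≠ 0} := fun hk => h ⟨k, hk⟩
    simpa [digit] using this
  have := eq_of_digit_eq hm h0
  omega

theorem digit_low_ne_zero {m : ℕ → ℕ} (hm : ∀ k, 2 ≤ m k) {n : ℕ} (hn : 1 ≤ n) :
    digit m n (low m n) ≠ 0 :=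
  Nat.sInf_mem (exists_digit_ne_zero hm hn)

theorem digit_high_ne_zero {m : ℕ → ℕ} (hm : ∀ k, 2 ≤ m k) {n : ℕ} (hn : 1 ≤ n) :
    digit m n (high m n) ≠ 0 :=
  Nat.sSup_mem (exists_digit_ne_zero hm hn) (finite_setOf_digit_ne_zero hm n).bddAbove

theorem digit_eq_zero_of_lt_low {m : ℕ → ℕ} {n j : ℕ} (h : j < low m n) : digit m n j = 0 := by
  simpa using Nat.notMem_of_lt_sInf h

theorem digit_eq_zero_of_high_lt {m : ℕ → ℕ} (hm : ∀ k, 2 ≤ m k) {n j : ℕ} (h : high m n < j) :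
    digit m n j = 0 := by
  by_contra h0
  exact absurd (le_csSup (finite_setOf_digit_ne_zero hm n).bddAbove h0) (not_le.2 h)

theorem low_le_high {m : ℕ → ℕ} (hm : ∀ k, 2 ≤ m k) (n : ℕ) : low m n ≤ high m n := by
  rcases Nat.eq_zero_or_pos n with rfl | hn
  · simp [low, high, digit]
  · exact Nat.sInf_le (digit_high_ne_zero hm hn)

theorem lt_M_high_succ {m : ℕ → ℕ} (hm : ∀ k, 2 ≤ m k) (n : ℕ) : n < M m (high m n + 1) := by
  have key : ∀ d k, d + k = high m n + 1 + n → high m n + 1 ≤ k → n / M m k = 0 := by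
    intro d
    induction d with
    | zero =>
      intro k hk _
      have h1 := lt_M_self hm k
      rw [Nat.div_eq_of_lt (by omega)]
    | succ d ih =>
      intro k hk hk'
      rw [← div_M_succ_mul_add_digit, ih (k + 1) (by omega) (by omega),
        digit_eq_zero_of_high_lt hm (by omega)]
      simp
  have := key n (high m n + 1) (by omega) le_rfl
  exact (Nat.div_eq_zero_iff_lt (M_pos hm _)).1 this

theorem M_high_le {m : ℕ → ℕ} (hm : ∀ k, 2 ≤ m k) {n : ℕ} (hn : 1 ≤ n) :
    M m (high m n) ≤ n := by
  by_contra h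
  exact digit_high_ne_zero hm hn (digit_eq_zero_of_lt hm (not_le.1 h) le_rfl)

/-! ### Vilenkin functions -/

theorem psi_eq_prod {m : ℕ → ℕ} (hm : ∀ k, 2 ≤ m k) {n N : ℕ} (h : n < M m N) (x : Group m) :
    psi m n x = ∏ k ∈ Finset.range N, rademacher m k x ^ digit m n k := by
  refine finprod_eq_prod_of_mulSupport_subset _ fun k hk => ?_
  by_contra hkN
  refine hk ?_
  simp only [Finset.coe_range, Set.mem_Iio, not_lt] at hkN
  simp [digit_eq_zero_of_lt hm h hkN]

theorem psi_zero (m : ℕ → ℕ) (x : Group m) : psi m 0 x = 1 := by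
  simp [psi, digit]

theorem psi_mul_add {m : ℕ → ℕ} (hm : ∀ k, 2 ≤ m k) (q : ℕ) {l j : ℕ} (hl : l < M m j)
    (x : Group m) : psi m (q * M m j + l) x = psi m (q * M m j) x * psi m l x := by
  set N := q * M m j + l
  have hN := lt_M_self hm N
  rw [psi_eq_prod hm hN, psi_eq_prod hm (n := q * M m j) (N := N) (by omega),
    psi_eq_prod hm (n := l) (N := N) (by omega), ← Finset.prod_mul_distrib]
  exact Finset.prod_congr rfl fun k _ => by rw [digit_mul_add hm q hl, pow_add]

theorem psi_mul_M {m : ℕ → ℕ} (hm : ∀ k, 2 ≤ m k) {s j : ℕ} (hs : s < m j) (x : Group m) :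
    psi m (s * M m j) x = rademacher m j x ^ s := by
  rw [psi, finprod_eq_single _ j fun k hk => by simp [digit_mul_M hm hs, hk]]
  simp [digit_mul_M hm hs]

theorem rademacher_eq (m : ℕ → ℕ) (k : ℕ) (x : Group m) :
    rademacher m k x =
      Complex.exp (((2 * Real.pi * ((x k).val : ℝ) / (m k : ℝ) : ℝ) : ℂ) * Complex.I) := by
  rw [rademacher]
  congr 1
  push_cast
  ring

theorem norm_rademacher (m : ℕ → ℕ) (k : ℕ) (x : Group m) : ‖rademacher m k x‖ = 1 := by
  rw [rademacher_eq, Complex.norm_exp_ofReal_mul_I]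

theorem norm_psi {m : ℕ → ℕ} (hm : ∀ k, 2 ≤ m k) (n : ℕ) (x : Group m) : ‖psi m n x‖ = 1 := by
  rw [psi_eq_prod hm (lt_M_self hm n), norm_prod]
  simp [norm_rademacher]

theorem rademacher_congr {m : ℕ → ℕ} {k : ℕ} {x y : Group m} (h : x k = y k) :
    rademacher m k x = rademacher m k y := by
  rw [rademacher, rademacher, h]

theorem rademacher_pow_card {m : ℕ → ℕ} (hm : ∀ k, 2 ≤ m k) (k : ℕ) (x : Group m) :
    rademacher m k x ^ m k = 1 := by
  have h0 : (m k : ℂ) ≠ 0 := by have := hm k; exact_mod_cast (by omega : m k ≠ 0)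
  rw [rademacher, ← Complex.exp_nat_mul, mul_div_cancel₀ _ h0]
  have := Complex.exp_nat_mul_two_pi_mul_I (x k).val
  rw [← this]
  congr 1
  ring

theorem eq_of_rademacher_eq {m : ℕ → ℕ} (hm : ∀ k, 2 ≤ m k) {k : ℕ} {x y : Group m}
    (h : rademacher m k x = rademacher m k y) : x k = y k := by
  have hk : m k ≠ 0 := by have := hm k; omega
  have : NeZero (m k) := ⟨hk⟩
  have hprim := Complex.isPrimitiveRoot_exp (m k) hk
  have e : ∀ z : Group m, rademacher m k z =
      Complex.exp (2 * Real.pi * Complex.I / (m k : ℂ)) ^ (z k).val := fun z => by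
    rw [rademacher, ← Complex.exp_nat_mul]
    congr 1
    ring
  rw [e, e] at h
  exact ZMod.val_injective _ (hprim.pow_inj (ZMod.val_lt _) (ZMod.val_lt _) h)

/-! ### Dirichlet kernels -/

/-- The kernel `∑_{i<n} ψ_i(x) conj ψ_i(t)` of the partial sum operator `S_n`. -/
noncomputable def kernel (m : ℕ → ℕ) (n : ℕ) (x t : Group m) : ℂ :=
  ∑ i ∈ Finset.range n, psi m i x * (starRingEnd ℂ) (psi m i t)

/-- The ratio `r_k(x - t)` of two values of a Rademacher function. -/
noncomputable def rademacherRatio (m : ℕ → ℕ) (k : ℕ) (x t : Group m) : ℂ :=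
  rademacher m k x * (starRingEnd ℂ) (rademacher m k t)

theorem norm_rademacherRatio (m : ℕ → ℕ) (k : ℕ) (x t : Group m) :
    ‖rademacherRatio m k x t‖ = 1 := by
  simp [rademacherRatio, norm_rademacher]

theorem rademacherRatio_eq_one_iff {m : ℕ → ℕ} (hm : ∀ k, 2 ≤ m k) {k : ℕ} {x t : Group m} :
    rademacherRatio m k x t = 1 ↔ x k = t k := by
  have h1 : rademacher m k t * (starRingEnd ℂ) (rademacher m k t) = 1 := by
    rw [Complex.mul_conj']
    simp [norm_rademacher]
  constructor
  · intro h
    refine eq_of_rademacher_eq hm ?_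
    calc rademacher m k x = rademacherRatio m k x t * rademacher m k t := by
          rw [rademacherRatio, mul_assoc, mul_comm ((starRingEnd ℂ) _), h1, mul_one]
      _ = _ := by rw [h, one_mul]
  · intro h
    rw [rademacherRatio, rademacher_congr h, h1]

theorem rademacherRatio_pow_card {m : ℕ → ℕ} (hm : ∀ k, 2 ≤ m k) (k : ℕ) (x t : Group m) :
    rademacherRatio m k x t ^ m k = 1 := by
  rw [rademacherRatio, mul_pow, ← map_pow, rademacher_pow_card hm, rademacher_pow_card hm]
  simp

/-- For `l < M_j` the function with index `(q m_j + s) M_j + l` factors as `ψ_{q M_{j+1}} r_j^s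
ψ_l`. Summing over `l` produces `D_{M_j}`, and summing over `s < d` a geometric sum in `r_j(x - t)`.
-/
theorem kernel_block {m : ℕ → ℕ} (hm : ∀ k, 2 ≤ m k) (q j : ℕ) {d : ℕ} (hd : d ≤ m j)
    (x t : Group m) :
    kernel m ((q * m j + d) * M m j) x t = kernel m (q * m j * M m j) x t +
      psi m (q * M m (j + 1)) x * (starRingEnd ℂ) (psi m (q * M m (j + 1)) t) *
        (kernel m (M m j) x t * ∑ s ∈ Finset.range d, rademacherRatio m j x t ^ s) := by
  induction d with
  | zero => simp
  | succ d ih =>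
    have e : (q * m j + (d + 1)) * M m j = (q * m j + d) * M m j + M m j := by ring
    rw [e, kernel, Finset.sum_range_add, ← kernel, ih (by omega), Finset.sum_range_succ, add_assoc,
      mul_add, mul_add]
    congr 2
    have hd' : d < m j := hd
    have hpsi : ∀ l ∈ Finset.range (M m j), ∀ z : Group m,
        psi m ((q * m j + d) * M m j + l) z =
          psi m (q * M m (j + 1)) z * rademacher m j z ^ d * psi m l z := by
      intro l hl z
      have hl := Finset.mem_range.1 hl
      have e2 : (q * m j + d) * M m j = q * M m (j + 1) + d * M m j := by rw [M_succ]; ring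
      rw [psi_mul_add hm _ hl, e2, psi_mul_add hm q (l := d * M m j) (j := j + 1)
        (Nat.mul_lt_mul_of_pos_right hd' (M_pos hm j)), psi_mul_M hm hd']
    rw [kernel, Finset.sum_mul, Finset.mul_sum]
    refine Finset.sum_congr rfl fun l hl => ?_
    rw [hpsi l hl, hpsi l hl, rademacherRatio]
    simp only [map_mul, map_pow, mul_pow]
    ring

/-- Paley's lemma. Passing from `k` to `k+1` multiplies by a full geometric sum of an `m_k`-th root
of unity, which is `m_k` if `x_k = t_k` and `0` otherwise. -/
theorem kernel_M {m : ℕ → ℕ} (hm : ∀ k, 2 ≤ m k) (k : ℕ) (x t : Group m) :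
    kernel m (M m k) x t = (I m k x).indicator (fun _ => (M m k : ℂ)) t := by
  induction k with
  | zero => simp [kernel, M, I, psi_zero]
  | succ k ih =>
    have h := kernel_block hm 0 k le_rfl x t
    simp only [zero_mul, zero_add, psi_zero, map_one, one_mul] at h
    rw [M_succ, h, ih]
    have h0 : kernel m 0 x t = 0 := by simp [kernel]
    rw [h0, zero_add]
    by_cases hk : x k = t k
    · have h1 : t ∈ I m (k + 1) x ↔ t ∈ I m k x := by
        refine ⟨fun h j hj => h j (by omega), fun h j hj => ?_⟩
        rcases Nat.lt_succ_iff_lt_or_eq.1 hj with h' | rfl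
        · exact h j h'
        · exact hk.symm
      rw [(rademacherRatio_eq_one_iff hm).2 hk]
      by_cases ht : t ∈ I m k x
      · simp [Set.indicator_of_mem ht, Set.indicator_of_mem (h1.2 ht), mul_comm]
      · simp [Set.indicator_of_notMem ht, Set.indicator_of_notMem (fun h => ht (h1.1 h))]
    · have hne : rademacherRatio m k x t ≠ 1 := fun h => hk ((rademacherRatio_eq_one_iff hm).1 h)
      rw [geom_sum_eq hne, rademacherRatio_pow_card hm, sub_self, zero_div, mul_zero,
        Set.indicator_of_notMem]
      exact fun h => hk (h k (Nat.lt_succ_self k)).symm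

/-- `n / M_j * M_j` is `n` with its digits below `j` erased, so iterating this step over `j` expands
`D_n` digit by digit. -/
theorem kernel_digit_step {m : ℕ → ℕ} (hm : ∀ k, 2 ≤ m k) (n j : ℕ) (x t : Group m) :
    kernel m (n / M m j * M m j) x t = kernel m (n / M m (j + 1) * M m (j + 1)) x t +
      psi m (n / M m (j + 1) * M m (j + 1)) x *
        (starRingEnd ℂ) (psi m (n / M m (j + 1) * M m (j + 1)) t) *
        (kernel m (M m j) x t *
          ∑ s ∈ Finset.range (digit m n j), rademacherRatio m j x t ^ s) := by
  have h := kernel_block hm (n / M m (j + 1)) j (digit_lt hm n j).le x t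
  rw [div_M_succ_mul_add_digit, mul_assoc _ (m j), ← M_succ] at h
  exact h

theorem div_M_low_mul {m : ℕ → ℕ} (n : ℕ) :
    n / M m (low m n) * M m (low m n) = n := by
  have key : ∀ j ≤ low m n, n / M m j * M m j = n := by
    intro j
    induction j with
    | zero => simp [M]
    | succ j ih =>
      intro hj
      conv_rhs => rw [← ih (by omega), ← div_M_succ_mul_add_digit,
        digit_eq_zero_of_lt_low (show j < low m n by omega), add_zero, mul_assoc, ← M_succ]
  exact key _ le_rfl

theorem norm_kernel_le {m : ℕ → ℕ} (hm : ∀ k, 2 ≤ m k) (n : ℕ) (x t : Group m) :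
    ‖kernel m n x t‖ ≤ ∑ j ∈ Finset.Ico (low m n) (high m n + 1),
      (I m j x).indicator (fun _ => (m j * M m j : ℝ)) t := by
  -- Downward induction from `high m n + 1`, where the truncation of `n` is `0`, to `low m n`, where
  -- it is `n` itself.
  have key : ∀ j ≤ high m n + 1, ‖kernel m (n / M m j * M m j) x t‖ ≤
      ∑ j ∈ Finset.Ico j (high m n + 1), (I m j x).indicator (fun _ => (m j * M m j : ℝ)) t := by
    intro j hj
    induction hj using Nat.decreasingInduction with
    | self => simp [Nat.div_eq_of_lt (lt_M_high_succ hm n), kernel]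
    | of_succ j hj ih =>
      rw [kernel_digit_step hm, Finset.sum_eq_sum_Ico_succ_bot (by omega), add_comm]
      refine (norm_add_le _ _).trans (add_le_add ?_ ih)
      rw [norm_mul, norm_mul, norm_mul, RCLike.norm_conj, norm_psi hm, norm_psi hm, kernel_M hm,
        one_mul, one_mul]
      have hs : ‖∑ s ∈ Finset.range (digit m n j), rademacherRatio m j x t ^ s‖ ≤ m j := by
        refine (norm_sum_le _ _).trans ?_
        simp only [norm_pow, norm_rademacherRatio, one_pow, Finset.sum_const, Finset.card_range,
          nsmul_eq_mul, mul_one]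
        exact_mod_cast (digit_lt hm n j).le
      by_cases ht : t ∈ I m j x
      · simp only [Set.indicator_of_mem ht, Complex.norm_natCast]
        rw [mul_comm]
        gcongr
      · simp [Set.indicator_of_notMem ht]
  have h := key (low m n) ((low_le_high hm n).trans (Nat.le_succ _))
  rwa [div_M_low_mul] at h

/-- On `I_a \ I_{a+1}`, `a = ⟨n⟩`, the Dirichlet kernel reduces to the block of its lowest digit. -/
theorem norm_kernel_eq {m : ℕ → ℕ} (hm : ∀ k, 2 ≤ m k) (n : ℕ) {x t : Group m}
    (h : t ∈ I m (low m n) x) (h' : x (low m n) ≠ t (low m n)) :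
    ‖kernel m n x t‖ = M m (low m n) *
      ‖∑ s ∈ Finset.range (digit m n (low m n)), rademacherRatio m (low m n) x t ^ s‖ := by
  -- Blocks with `j > low m n` carry the factor `D_{M_j}(x - t)`, which vanishes because `x` and `t`
  -- already differ at coordinate `low m n`.
  have key : ∀ j ≤ high m n + 1, low m n < j → kernel m (n / M m j * M m j) x t = 0 := by
    intro j hj
    induction hj using Nat.decreasingInduction with
    | self => simp [Nat.div_eq_of_lt (lt_M_high_succ hm n), kernel]
    | of_succ j hj ih =>
      intro hlj
      rw [kernel_digit_step hm, ih (by omega), kernel_M hm, Set.indicator_of_notMem]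
      · simp
      · exact fun h => h' (h _ hlj).symm
  have h1 := kernel_digit_step hm n (low m n) x t
  rw [div_M_low_mul, key _ (by have := low_le_high hm n; omega) (Nat.lt_succ_self _), zero_add,
    kernel_M hm, Set.indicator_of_mem h] at h1
  rw [h1]
  simp [norm_psi hm]

/-! ### The Haar measure -/

theorem neZero_of_two_le {m : ℕ → ℕ} (hm : ∀ k, 2 ≤ m k) (k : ℕ) : NeZero (m k) :=
  ⟨by have := hm k; omega⟩

theorem isProbabilityMeasure_haar {m : ℕ → ℕ} (hm : ∀ k, 2 ≤ m k) :
    IsProbabilityMeasure (haar m) := by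
  have := neZero_of_two_le hm
  rw [haar]
  infer_instance

theorem uniformOn_univ_singleton {m : ℕ} [NeZero m] (z : ZMod m) :
    uniformOn (Set.univ : Set (ZMod m)) {z} = (m : ℝ≥0∞)⁻¹ := by
  rw [uniformOn_univ, Measure.count_singleton, ZMod.card, one_div]

theorem haar_I {m : ℕ → ℕ} (hm : ∀ k, 2 ≤ m k) (n : ℕ) (x : Group m) :
    haar m (I m n x) = (M m n : ℝ≥0∞)⁻¹ := by
  have := neZero_of_two_le hm
  have h : I m n x = Set.pi (Finset.range n : Set ℕ) fun j => {x j} := by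
    ext y; simp [I, Set.mem_pi]
  rw [h, haar, Measure.infinitePi_pi _ fun j _ => measurableSet_singleton _]
  simp only [uniformOn_univ_singleton]
  induction n with
  | zero => simp [M]
  | succ n ih =>
    have h' : I m n x = Set.pi (Finset.range n : Set ℕ) fun j => {x j} := by
      ext y; simp [I, Set.mem_pi]
    rw [Finset.prod_range_succ, ih h', M_succ, Nat.cast_mul,
      ENNReal.mul_inv (Or.inr (by simp)) (Or.inl (by simp)), mul_comm]

theorem measurePreserving_add_right {m : ℕ → ℕ} (hm : ∀ k, 2 ≤ m k) (e : Group m) :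
    MeasurePreserving (fun x => x + e) (haar m) (haar m) := by
  have := neZero_of_two_le hm
  have hmap : ∀ k, (uniformOn (Set.univ : Set (ZMod (m k)))).map (fun z => z + e k) =
      uniformOn Set.univ := fun k => by
    refine Measure.ext_of_singleton fun z => ?_
    rw [Measure.map_apply .of_discrete (measurableSet_singleton z)]
    have : (fun w => w + e k) ⁻¹' {z} = {z - e k} := by
      ext w
      exact eq_sub_iff_add_eq.symm
    rw [this, uniformOn_univ_singleton, uniformOn_univ_singleton]
  refine ⟨measurable_pi_lambda _ fun k =>
    (Measurable.of_discrete (f := fun z => z + e k)).comp (measurable_pi_apply k), ?_⟩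
  have h := Measure.infinitePi_map_pi (fun k => uniformOn (Set.univ : Set (ZMod (m k))))
    (f := fun k z => z + e k) fun k => .of_discrete
  simp only [hmap] at h
  exact h

/-! ### Orthonormality of the Vilenkin system -/

theorem rademacher_eq_stdAddChar {m : ℕ → ℕ} (k : ℕ) [NeZero (m k)] (x : Group m) :
    rademacher m k x = ZMod.stdAddChar (x k) := by
  rw [rademacher, ZMod.stdAddChar_apply, ZMod.toCircle_apply]

theorem measurable_rademacher {m : ℕ → ℕ} (hm : ∀ k, 2 ≤ m k) (k : ℕ) :
    Measurable (rademacher m k) := by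
  have := neZero_of_two_le hm
  have h : rademacher m k = (fun z : ZMod (m k) => ZMod.stdAddChar z) ∘ fun x => x k :=
    funext fun x => rademacher_eq_stdAddChar k x
  rw [h]
  exact Measurable.of_discrete.comp (measurable_pi_apply k)

theorem measurable_psi {m : ℕ → ℕ} (hm : ∀ k, 2 ≤ m k) (n : ℕ) : Measurable (psi m n) := by
  rw [funext (psi_eq_prod hm (lt_M_self hm n))]
  exact Finset.measurable_prod _ fun k _ => (measurable_rademacher hm k).pow_const _

theorem integrable_mul_conj_psi {m : ℕ → ℕ} (hm : ∀ k, 2 ≤ m k) {g : Group m → ℂ}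
    (hg : Integrable g (haar m)) (i : ℕ) :
    Integrable (fun x => g x * (starRingEnd ℂ) (psi m i x)) (haar m) := by
  refine hg.mul_bdd (c := 1) ?_ (ae_of_all _ fun x => ?_)
  · exact (Complex.continuous_conj.measurable.comp (measurable_psi hm i)).aestronglyMeasurable
  · rw [RCLike.norm_conj, norm_psi hm]

theorem integrable_psi {m : ℕ → ℕ} (hm : ∀ k, 2 ≤ m k) (n : ℕ) :
    Integrable (psi m n) (haar m) := by
  have := isProbabilityMeasure_haar hm
  exact Integrable.of_bound (measurable_psi hm n).aestronglyMeasurable 1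
    (ae_of_all _ fun x => (norm_psi hm n x).le)

theorem psi_add_single {m : ℕ → ℕ} (hm : ∀ k, 2 ≤ m k) (n k : ℕ) [NeZero (m k)]
    (x : Group m) :
    psi m n (x + Pi.single k 1) = ZMod.stdAddChar (1 : ZMod (m k)) ^ digit m n k * psi m n x := by
  have hinst := neZero_of_two_le hm
  have hN : n < M m (n + k + 1) :=
    (lt_M_self hm n).trans_le (M_mono hm (by omega))
  set y : Group m := x + Pi.single k 1 with hy
  have hyk : y k = x k + 1 := by simp [hy]
  have hyj : ∀ j ≠ k, y j = x j := fun j hj => by simp [hy, hj]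
  have hk : k ∈ Finset.range (n + k + 1) := Finset.mem_range.2 (by omega)
  rw [psi_eq_prod hm hN, psi_eq_prod hm hN,
    ← Finset.mul_prod_erase _ (fun j => rademacher m j y ^ digit m n j) hk,
    ← Finset.mul_prod_erase _ (fun j => rademacher m j x ^ digit m n j) hk, ← mul_assoc, ← mul_pow]
  congr 1
  · rw [rademacher_eq_stdAddChar, rademacher_eq_stdAddChar, hyk, AddChar.map_add_eq_mul, mul_comm]
  · exact Finset.prod_congr rfl fun j hj => by
      rw [rademacher_congr (hyj j (Finset.mem_erase.1 hj).1)]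

/-- If the digits of `i` and `j` differ at `k`, translation by the unit vector at `k` multiplies the
integrand by a constant `c ≠ 1`. Invariance of the measure then forces the integral to vanish. -/
theorem integral_psi_mul_conj_psi {m : ℕ → ℕ} (hm : ∀ k, 2 ≤ m k) (i j : ℕ) :
    ∫ x, psi m i x * (starRingEnd ℂ) (psi m j x) ∂haar m = if i = j then 1 else 0 := by
  have := isProbabilityMeasure_haar hm
  split_ifs with hij
  · subst hij
    simp [Complex.mul_conj', norm_psi hm]
  · obtain ⟨k, hk⟩ : ∃ k, digit m i k ≠ digit m j k := by
      by_contra! h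
      exact hij (eq_of_digit_eq hm h)
    have hinst := neZero_of_two_le hm k
    set ω : ℂ := ZMod.stdAddChar (1 : ZMod (m k)) with hω
    set c : ℂ := ω ^ digit m i k * (starRingEnd ℂ) (ω ^ digit m j k) with hc
    have hωn : ω * (starRingEnd ℂ) ω = 1 := by
      rw [Complex.mul_conj', hω]
      simp [ZMod.stdAddChar_apply, Circle.norm_coe]
    have hpow : ∀ d : ℕ, ω ^ d = ZMod.stdAddChar (d : ZMod (m k)) := fun d => by
      rw [hω, ← AddChar.map_nsmul_eq_pow, nsmul_eq_mul, mul_one]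
    have hc1 : c ≠ 1 := by
      intro h
      have h2 : ω ^ digit m i k = ω ^ digit m j k := by
        calc ω ^ digit m i k = c * ω ^ digit m j k := by
              rw [hc, mul_assoc, map_pow, ← mul_pow, mul_comm _ ω, hωn, one_pow, mul_one]
          _ = _ := by rw [h, one_mul]
      rw [hpow, hpow] at h2
      have h3 := congrArg ZMod.val (ZMod.injective_stdAddChar h2)
      rw [ZMod.val_natCast_of_lt (digit_lt hm i k), ZMod.val_natCast_of_lt (digit_lt hm j k)] at h3
      exact hk h3
    set J := ∫ x, psi m i x * (starRingEnd ℂ) (psi m j x) ∂haar m with hJ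
    have h1 : J = c * J := by
      have hmp := measurePreserving_add_right hm (Pi.single k 1)
      rw [hJ, ← integral_const_mul]
      conv_lhs => rw [← hmp.map_eq]
      rw [integral_map hmp.measurable.aemeasurable]
      · refine integral_congr_ae (ae_of_all _ fun x => ?_)
        simp only [psi_add_single hm, map_mul, hc]
        ring
      · exact ((measurable_psi hm i).mul (Complex.continuous_conj.measurable.comp
          (measurable_psi hm j))).aestronglyMeasurable
    have h2 : (c - 1) * J = 0 := by rw [sub_mul, one_mul, ← h1, sub_self]
    exact (mul_eq_zero.1 h2).resolve_left (sub_ne_zero.2 hc1)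

theorem coeffFun_sum {m : ℕ → ℕ} (hm : ∀ k, 2 ≤ m k) (n : ℕ) (a : ℕ → ℂ) (j : ℕ) :
    coeffFun m (fun x => ∑ i ∈ Finset.range n, a i * psi m i x) j = if j < n then a j else 0 := by
  simp only [coeffFun, Finset.sum_mul]
  rw [integral_finsetSum]
  · simp only [mul_assoc, integral_const_mul, integral_psi_mul_conj_psi hm]
    simp
  · intro i _
    exact integrable_mul_conj_psi hm ((integrable_psi hm i).const_mul (a i)) j

theorem coeff_unique {m : ℕ → ℕ} (hm : ∀ k, 2 ≤ m k) {n : ℕ} {a b : ℕ → ℂ}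
    (h : ∀ x, ∑ i ∈ Finset.range n, a i * psi m i x = ∑ i ∈ Finset.range n, b i * psi m i x)
    {i : ℕ} (hi : i < n) : a i = b i := by
  have h1 := coeffFun_sum hm n a i
  rw [funext h, coeffFun_sum hm n b i, if_pos hi, if_pos hi] at h1
  exact h1.symm

/-! ### Partial sums of functions -/

theorem partialSumFun_eq_integral {m : ℕ → ℕ} (hm : ∀ k, 2 ≤ m k) {g : Group m → ℂ}
    (hg : Integrable g (haar m)) (n : ℕ) (x : Group m) :
    partialSumFun m n g x = ∫ t, g t * kernel m n x t ∂haar m := by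
  simp only [partialSumFun, coeffFun, kernel, Finset.mul_sum]
  rw [integral_finsetSum]
  · refine Finset.sum_congr rfl fun i _ => ?_
    rw [← integral_mul_const]
    exact integral_congr_ae (ae_of_all _ fun t => by ring)
  · intro i _
    have := (integrable_mul_conj_psi hm hg i).mul_const (psi m i x)
    exact this.congr (ae_of_all _ fun t => by ring)

theorem partialSumFun_M {m : ℕ → ℕ} (hm : ∀ k, 2 ≤ m k) {g : Group m → ℂ}
    (hg : Integrable g (haar m)) (k : ℕ) (x : Group m) :
    partialSumFun m (M m k) g x = M m k * ∫ t in I m k x, g t ∂haar m := by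
  rw [partialSumFun_eq_integral hm hg, ← integral_const_mul,
    ← integral_indicator (measurableSet_I m k x)]
  refine integral_congr_ae (ae_of_all _ fun t => ?_)
  simp only [kernel_M hm]
  by_cases ht : t ∈ I m k x
  · simp [Set.indicator_of_mem ht, mul_comm]
  · simp [Set.indicator_of_notMem ht]

/-! ### Martingales -/

/-- Sets of the `k`-th σ-algebra cannot separate points sharing their first `k` coordinates. Hence
adapted functions are honestly, not just almost everywhere, constant on intervals, and the
identities below hold at every point. -/
theorem mem_iff_of_measurableSet_filtration {m : ℕ → ℕ} (hm : ∀ k, 2 ≤ m k) {k : ℕ}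
    {s : Set (Group m)} (hs : MeasurableSet[filtration m hm k] s) {x y : Group m}
    (hxy : ∀ j < k, x j = y j) : x ∈ s ↔ y ∈ s := by
  induction s, hs using MeasurableSpace.generateFrom_induction with
  | hC t ht _ =>
    obtain ⟨z, rfl⟩ := ht
    exact ⟨fun h j hj => (hxy j hj).symm.trans (h j hj), fun h j hj => (hxy j hj).trans (h j hj)⟩
  | empty => simp
  | compl t _ ih => simp [ih]
  | iUnion s _ ih => simp [ih]

theorem eq_of_stronglyMeasurable_filtration {m : ℕ → ℕ} (hm : ∀ k, 2 ≤ m k) {k : ℕ}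
    {g : Group m → ℂ} (hg : StronglyMeasurable[filtration m hm k] g) {x y : Group m}
    (hxy : ∀ j < k, x j = y j) : g x = g y := by
  have hs : MeasurableSet[filtration m hm k] (g ⁻¹' {g x}) :=
    hg.measurable (measurableSet_singleton _)
  exact ((mem_iff_of_measurableSet_filtration hm hs hxy).1 rfl).symm

theorem I_measurableSet_filtration {m : ℕ → ℕ} (hm : ∀ k, 2 ≤ m k) {j k : ℕ} (hjk : j ≤ k)
    (x : Group m) : MeasurableSet[filtration m hm k] (I m j x) :=
  measurableSet_I_of_le (fun k => by have := hm k; omega) hjk x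

theorem mul_setIntegral_I {m : ℕ → ℕ} (hm : ∀ k, 2 ≤ m k) {k : ℕ} {g : Group m → ℂ}
    (hg : StronglyMeasurable[filtration m hm k] g) (x : Group m) :
    M m k * ∫ t in I m k x, g t ∂haar m = g x := by
  have h : ∫ t in I m k x, g t ∂haar m = ∫ _ in I m k x, g x ∂haar m :=
    setIntegral_congr_fun (measurableSet_I m k x) fun t ht =>
      eq_of_stronglyMeasurable_filtration hm hg ht
  have h0 : (M m k : ℂ) ≠ 0 := by exact_mod_cast (M_pos hm k).ne'
  rw [h, setIntegral_const, measureReal_def, haar_I hm]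
  simp [h0]

/-- `S_{M_k}` averages over the intervals of rank `k`, so it acts as conditional expectation. -/
theorem partialSumFun_M_martingale {m : ℕ → ℕ} {hm : ∀ k, 2 ≤ m k} {f : ℕ → Group m → ℂ}
    (hf : Martingale f (filtration m hm) (haar m)) {k l : ℕ} (hkl : k ≤ l) (x : Group m) :
    partialSumFun m (M m k) (f l) x = f k x := by
  have := isProbabilityMeasure_haar hm
  rw [partialSumFun_M hm (hf.integrable l),
    ← hf.setIntegral_eq hkl (I_measurableSet_filtration hm le_rfl x),
    mul_setIntegral_I hm (hf.stronglyMeasurable k)]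

/-- For `l ≥ k` both `f_k` and `f_l` have `S_{M_k}` equal to `f_k`. Orthonormality then identifies
their coefficients below `M_k`, so the sequence defining `coeff` is constant from `k` on. -/
theorem coeff_eq {m : ℕ → ℕ} {hm : ∀ k, 2 ≤ m k} {f : ℕ → Group m → ℂ}
    (hf : Martingale f (filtration m hm) (haar m)) {i k : ℕ} (hi : i < M m k) :
    coeff m f i = coeffFun m (f k) i := by
  refine Tendsto.limUnder_eq (tendsto_const_nhds.congr' ?_)
  filter_upwards [eventually_ge_atTop k] with l hl
  refine coeff_unique hm (a := coeffFun m (f k)) (b := coeffFun m (f l)) (fun x => ?_) hi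
  exact (partialSumFun_M_martingale hf le_rfl x).trans (partialSumFun_M_martingale hf hl x).symm

theorem partialSum_eq {m : ℕ → ℕ} {hm : ∀ k, 2 ≤ m k} {f : ℕ → Group m → ℂ}
    (hf : Martingale f (filtration m hm) (haar m)) {n k : ℕ} (hn : n ≤ M m k) :
    partialSum m n f = partialSumFun m n (f k) :=
  funext fun _ => Finset.sum_congr rfl fun i hi => by
    rw [coeff_eq hf ((Finset.mem_range.1 hi).trans_le hn)]

theorem partialSum_M {m : ℕ → ℕ} {hm : ∀ k, 2 ≤ m k} {f : ℕ → Group m → ℂ}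
    (hf : Martingale f (filtration m hm) (haar m)) (k : ℕ) : partialSum m (M m k) f = f k := by
  rw [partialSum_eq hf le_rfl]
  exact funext (partialSumFun_M_martingale hf le_rfl)

theorem partialSumFun_partialSum {m : ℕ → ℕ} (hm : ∀ k, 2 ≤ m k) (f : ℕ → Group m → ℂ)
    (l n : ℕ) : partialSumFun m l (partialSum m n f) = partialSum m (min l n) f := by
  funext x
  have h : ∀ i, coeffFun m (partialSum m n f) i = if i < n then coeff m f i else 0 :=
    coeffFun_sum hm n _
  simp only [partialSumFun, h, ite_mul, zero_mul]
  rw [← Finset.sum_filter, partialSum]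
  refine Finset.sum_congr ?_ fun _ _ => rfl
  ext i
  simp

/-! ### The upper estimate -/

theorem enorm_kernel_le {m : ℕ → ℕ} (hm : ∀ k, 2 ≤ m k) (n : ℕ) (x t : Group m) :
    ‖kernel m n x t‖ₑ ≤ ∑ j ∈ Finset.Ico (low m n) (high m n + 1),
      (I m j x).indicator (fun _ => ((m j * M m j : ℕ) : ℝ≥0∞)) t := by
  rw [← ofReal_norm]
  refine (ENNReal.ofReal_le_ofReal (norm_kernel_le hm n x t)).trans_eq ?_
  rw [ENNReal.ofReal_sum_of_nonneg fun j _ => Set.indicator_nonneg (fun _ _ => by positivity) t]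
  refine Finset.sum_congr rfl fun j _ => ?_
  by_cases ht : t ∈ I m j x
  · rw [Set.indicator_of_mem ht, Set.indicator_of_mem ht, ← Nat.cast_mul, ENNReal.ofReal_natCast]
  · rw [Set.indicator_of_notMem ht, Set.indicator_of_notMem ht, ENNReal.ofReal_zero]

theorem enorm_partialSumFun_le {m : ℕ → ℕ} (hm : ∀ k, 2 ≤ m k) {g : Group m → ℂ}
    (hg : Integrable g (haar m)) (hgm : Measurable g) (n : ℕ) (x : Group m) :
    ‖partialSumFun m n g x‖ₑ ≤ ∑ j ∈ Finset.Ico (low m n) (high m n + 1),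
      ((m j * M m j : ℕ) : ℝ≥0∞) * ∫⁻ t in I m j x, ‖g t‖ₑ ∂haar m := by
  rw [partialSumFun_eq_integral hm hg]
  refine (enorm_integral_le_lintegral_enorm _).trans ?_
  have hind : ∀ j t, ‖g t‖ₑ * (I m j x).indicator (fun _ => ((m j * M m j : ℕ) : ℝ≥0∞)) t =
      (I m j x).indicator (fun t => ((m j * M m j : ℕ) : ℝ≥0∞) * ‖g t‖ₑ) t := fun j t => by
    by_cases ht : t ∈ I m j x
    · rw [Set.indicator_of_mem ht, Set.indicator_of_mem ht, mul_comm]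
    · rw [Set.indicator_of_notMem ht, Set.indicator_of_notMem ht, mul_zero]
  calc ∫⁻ t, ‖g t * kernel m n x t‖ₑ ∂haar m
      ≤ ∫⁻ t, ∑ j ∈ Finset.Ico (low m n) (high m n + 1),
          (I m j x).indicator (fun t => ((m j * M m j : ℕ) : ℝ≥0∞) * ‖g t‖ₑ) t ∂haar m := by
        refine lintegral_mono fun t => ?_
        rw [enorm_mul]
        refine (mul_le_mul_right (enorm_kernel_le hm n x t) _).trans_eq ?_
        rw [Finset.mul_sum]
        exact Finset.sum_congr rfl fun j _ => hind j t
    _ = _ := by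
        rw [lintegral_finsetSum _ fun j _ =>
          (hgm.enorm.const_mul _).indicator (measurableSet_I m j x)]
        refine Finset.sum_congr rfl fun j _ => ?_
        rw [lintegral_indicator (measurableSet_I m j x), lintegral_const_mul _ hgm.enorm]

theorem rpow_sum_le_sum_rpow {ι : Type*} (s : Finset ι) (u : ι → ℝ≥0∞) {p : ℝ} (hp0 : 0 < p)
    (hp1 : p ≤ 1) : (∑ i ∈ s, u i) ^ p ≤ ∑ i ∈ s, u i ^ p :=
  Finset.le_sum_of_subadditive (fun v : ℝ≥0∞ => v ^ p) (ENNReal.zero_rpow_of_pos hp0).le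
    (fun a b => ENNReal.rpow_add_le_add_rpow a b hp0.le hp1) s u

/-- Reverse Hölder inequality on an interval for functions constant on finer intervals. -/
theorem rpow_lintegral_I_le {m : ℕ → ℕ} (hm : ∀ k, 2 ≤ m k) {p : ℝ} (hp0 : 0 < p) (hp1 : p < 1)
    {N j : ℕ} (hj : j ≤ N) {g : Group m → ℂ} (hg : StronglyMeasurable[filtration m hm N] g)
    (hgi : Integrable g (haar m)) (hgm : Measurable g) (x : Group m) :
    (∫⁻ t in I m j x, ‖g t‖ₑ ∂haar m) ^ p ≤
      (M m N : ℝ≥0∞) ^ (1 - p) * ∫⁻ t in I m j x, ‖g t‖ₑ ^ p ∂haar m := by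
  set G := ∫⁻ t in I m j x, ‖g t‖ₑ ∂haar m with hG
  have hGtop : G ≠ ∞ := ((setLIntegral_le_lintegral _ _).trans_lt hgi.2).ne
  rcases eq_or_ne G 0 with h0 | h0
  · rw [h0, ENNReal.zero_rpow_of_pos hp0]
    exact zero_le
  have hM0 : (M m N : ℝ≥0∞) ≠ 0 := by exact_mod_cast (M_pos hm N).ne'
  -- `g` is constant on `I_N(t)`, a subset of `I_j(x)` of measure `1/M_N`, so a large value of `g`
  -- forces a large integral.
  have hpt : ∀ t ∈ I m j x, ‖g t‖ₑ ≤ M m N * G := by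
    intro t ht
    have h1 : ∫⁻ s in I m N t, ‖g s‖ₑ ∂haar m = ‖g t‖ₑ * (M m N : ℝ≥0∞)⁻¹ := by
      rw [setLIntegral_congr_fun (g := fun _ => ‖g t‖ₑ) (measurableSet_I m N t),
        setLIntegral_const, haar_I hm]
      intro s hs
      simp only [eq_of_stronglyMeasurable_filtration hm hg hs]
    have h2 : ∫⁻ s in I m N t, ‖g s‖ₑ ∂haar m ≤ G :=
      lintegral_mono_set fun s hs i hi => (hs i (hi.trans_le hj)).trans (ht i hi)
    rw [h1, ← div_eq_mul_inv, ENNReal.div_le_iff hM0 (ENNReal.natCast_ne_top _)] at h2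
    rwa [mul_comm]
  have hmain : G ≤ (M m N * G) ^ (1 - p) * ∫⁻ t in I m j x, ‖g t‖ₑ ^ p ∂haar m := by
    rw [← lintegral_const_mul _ (hgm.enorm.pow_const p), hG]
    refine setLIntegral_mono ((hgm.enorm.pow_const p).const_mul _) fun t ht => ?_
    calc ‖g t‖ₑ = ‖g t‖ₑ ^ (1 - p) * ‖g t‖ₑ ^ p := by
          rw [← ENNReal.rpow_add_of_nonneg _ _ (by linarith) hp0.le, sub_add_cancel,
            ENNReal.rpow_one]
      _ ≤ _ := by
          gcongr
          exact hpt t ht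
  -- Multiplying `hmain` by `G^{p-1}` cancels the factor `G^{1-p}`; this requires `G` to be neither
  -- `0` nor `∞`.
  calc G ^ p = G * G ^ (p - 1) := by
        conv_rhs => rw [← ENNReal.rpow_one G, ← ENNReal.rpow_mul, one_mul,
          ← ENNReal.rpow_add _ _ h0 hGtop]
        congr 1
        ring
    _ ≤ (M m N * G) ^ (1 - p) * (∫⁻ t in I m j x, ‖g t‖ₑ ^ p ∂haar m) * G ^ (p - 1) := by
        gcongr
    _ = (G ^ (1 - p) * G ^ (p - 1)) *
          ((M m N : ℝ≥0∞) ^ (1 - p) * ∫⁻ t in I m j x, ‖g t‖ₑ ^ p ∂haar m) := by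
        rw [ENNReal.mul_rpow_of_nonneg _ _ (by linarith)]
        ring
    _ = _ := by
        rw [← ENNReal.rpow_add _ _ h0 hGtop]
        simp

theorem mem_I_comm {m : ℕ → ℕ} {j : ℕ} {x t : Group m} : t ∈ I m j x ↔ x ∈ I m j t :=
  ⟨fun h i hi => (h i hi).symm, fun h i hi => (h i hi).symm⟩

theorem measurableSet_setOf_mem_I {m : ℕ → ℕ} (hm : ∀ k, 2 ≤ m k) (j : ℕ) :
    MeasurableSet {q : Group m × Group m | q.2 ∈ I m j q.1} := by
  have := neZero_of_two_le hm
  have h : {q : Group m × Group m | q.2 ∈ I m j q.1} =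
      ⋂ i ∈ Finset.range j, {q | q.2 i = q.1 i} := by
    ext q; simp [I]
  rw [h]
  exact Finset.measurableSet_biInter _ fun i _ => measurableSet_eq_fun
    ((measurable_pi_apply i).comp measurable_snd) ((measurable_pi_apply i).comp measurable_fst)

/-- Tonelli: each `t` is counted for the `x` in `I_j(t)`, a set of measure `1/M_j`. -/
theorem lintegral_lintegral_I {m : ℕ → ℕ} (hm : ∀ k, 2 ≤ m k) (j : ℕ) {h : Group m → ℝ≥0∞}
    (hh : Measurable h) :
    ∫⁻ x, ∫⁻ t in I m j x, h t ∂haar m ∂haar m = (M m j : ℝ≥0∞)⁻¹ * ∫⁻ t, h t ∂haar m := by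
  have := isProbabilityMeasure_haar hm
  have hS := measurableSet_setOf_mem_I hm j
  simp_rw [← lintegral_indicator (measurableSet_I m j _)]
  rw [lintegral_lintegral_swap]
  · rw [← lintegral_const_mul _ hh]
    refine lintegral_congr fun t => ?_
    have e : ∀ x, (I m j x).indicator h t = (I m j t).indicator (fun _ => h t) x := fun x => by
      by_cases ht : t ∈ I m j x
      · rw [Set.indicator_of_mem ht, Set.indicator_of_mem (mem_I_comm.1 ht)]
      · rw [Set.indicator_of_notMem ht, Set.indicator_of_notMem fun h => ht (mem_I_comm.1 h)]
    simp_rw [e]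
    rw [lintegral_indicator (measurableSet_I m j t), setLIntegral_const, haar_I hm, mul_comm]
  · exact ((hh.comp measurable_snd).indicator hS).aemeasurable

theorem lintegral_partialSumFun_le {m : ℕ → ℕ} (hm : ∀ k, 2 ≤ m k) {p : ℝ} (hp0 : 0 < p)
    (hp1 : p < 1) (n : ℕ) {g : Group m → ℂ}
    (hg : StronglyMeasurable[filtration m hm (high m n + 1)] g) (hgi : Integrable g (haar m)) :
    ∫⁻ x, ‖partialSumFun m n g x‖ₑ ^ p ∂haar m ≤
      (∑ j ∈ Finset.Ico (low m n) (high m n + 1), ((m j * M m j : ℕ) : ℝ≥0∞) ^ p *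
        ((M m (high m n + 1) : ℝ≥0∞) ^ (1 - p) * (M m j : ℝ≥0∞)⁻¹)) *
        ∫⁻ x, ‖g x‖ₑ ^ p ∂haar m := by
  have := isProbabilityMeasure_haar hm
  have hgm : Measurable g := hg.measurable.mono ((filtration m hm).le _) le_rfl
  have hgp : Measurable fun x => ‖g x‖ₑ ^ p := hgm.enorm.pow_const p
  -- The domain of integration varies with `x`. Writing it as a section of a measurable subset of
  -- the product gives measurability in `x`.
  have hint : ∀ j, Measurable fun x => ∫⁻ t in I m j x, ‖g t‖ₑ ^ p ∂haar m := by
    intro j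
    have h : (fun x => ∫⁻ t in I m j x, ‖g t‖ₑ ^ p ∂haar m) =
        fun x => ∫⁻ t, {q : Group m × Group m | q.2 ∈ I m j q.1}.indicator
          (fun q => ‖g q.2‖ₑ ^ p) (x, t) ∂haar m := funext fun x => by
      rw [← lintegral_indicator (measurableSet_I m j x)]
      rfl
    rw [h]
    have hS := measurableSet_setOf_mem_I hm j
    exact ((hgp.comp measurable_snd).indicator hS).lintegral_prod_right'
  calc ∫⁻ x, ‖partialSumFun m n g x‖ₑ ^ p ∂haar m
      ≤ ∫⁻ x, ∑ j ∈ Finset.Ico (low m n) (high m n + 1), ((m j * M m j : ℕ) : ℝ≥0∞) ^ p *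
          ((M m (high m n + 1) : ℝ≥0∞) ^ (1 - p) *
            ∫⁻ t in I m j x, ‖g t‖ₑ ^ p ∂haar m) ∂haar m := by
        refine lintegral_mono fun x => ?_
        refine (ENNReal.rpow_le_rpow (enorm_partialSumFun_le hm hgi hgm n x) hp0.le).trans ?_
        refine (rpow_sum_le_sum_rpow _ _ hp0 hp1.le).trans (Finset.sum_le_sum fun j hj => ?_)
        rw [ENNReal.mul_rpow_of_nonneg _ _ hp0.le]
        gcongr
        exact rpow_lintegral_I_le hm hp0 hp1 (Finset.mem_Ico.1 hj).2.le hg hgi hgm x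
    _ = _ := by
        rw [lintegral_finsetSum _ fun j _ => ((hint j).const_mul _).const_mul _, Finset.sum_mul]
        refine Finset.sum_congr rfl fun j _ => ?_
        rw [lintegral_const_mul _ ((hint j).const_mul _), lintegral_const_mul _ (hint j),
          lintegral_lintegral_I hm j hgp]
        ring

/-- Each summand equals `m_j^p M_{b+1}^{1-p} M_j^{p-1}`. Here `M_{b+1} ≤ L M_b`, and `M_j ≥ 2^{j-a}
M_a` with the negative exponent `p - 1` gives geometric decay of ratio `2^{p-1}`. The powers `L^p`
and `L^{1-p}` combine to `L`. -/
theorem geom_weight_sum_le {m : ℕ → ℕ} (hm : ∀ k, 2 ≤ m k) {L : ℕ} (hL : ∀ k, m k ≤ L) {p : ℝ}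
    (hp0 : 0 < p) (hp1 : p < 1) (a b : ℕ) :
    ∑ j ∈ Finset.Ico a (b + 1), ((m j * M m j : ℕ) : ℝ≥0∞) ^ p *
        ((M m (b + 1) : ℝ≥0∞) ^ (1 - p) * (M m j : ℝ≥0∞)⁻¹) ≤
      ENNReal.ofReal (L / (1 - 2 ^ (p - 1)) * ((M m b : ℝ) / M m a) ^ (1 - p)) := by
  have hMp : ∀ k, (0 : ℝ) < M m k := fun k => by exact_mod_cast M_pos hm k
  have hmp : ∀ k, (0 : ℝ) < m k := fun k => by
    have := hm k; exact_mod_cast (by omega : 0 < m k)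
  have hLp : (0 : ℝ) < L := (hmp 0).trans_le (by exact_mod_cast hL 0)
  set r : ℝ := 2 ^ (p - 1) with hr
  have hr0 : 0 < r := by positivity
  have hr1 : r < 1 := Real.rpow_lt_one_of_one_lt_of_neg one_lt_two (by linarith)
  have hterm : ∀ j ∈ Finset.Ico a (b + 1), ((m j * M m j : ℕ) : ℝ≥0∞) ^ p *
        ((M m (b + 1) : ℝ≥0∞) ^ (1 - p) * (M m j : ℝ≥0∞)⁻¹) ≤
      ENNReal.ofReal (L * ((M m b : ℝ) / M m a) ^ (1 - p) * r ^ (j - a)) := by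
    intro j hj
    have hj := Finset.mem_Ico.1 hj
    have e : ((m j * M m j : ℕ) : ℝ≥0∞) ^ p *
        ((M m (b + 1) : ℝ≥0∞) ^ (1 - p) * (M m j : ℝ≥0∞)⁻¹) =
        ENNReal.ofReal (((m j : ℝ) ^ p * (M m (b + 1) : ℝ) ^ (1 - p)) * (M m j : ℝ) ^ (p - 1)) := by
      rw [← ENNReal.ofReal_natCast, ← ENNReal.ofReal_natCast (M m j),
        ← ENNReal.ofReal_natCast (M m (b + 1)),
        ENNReal.ofReal_rpow_of_pos (by have := hmp j; have := hMp j; push_cast; positivity),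
        ENNReal.ofReal_rpow_of_pos (hMp _), ← ENNReal.ofReal_inv_of_pos (hMp j),
        ← ENNReal.ofReal_mul (by positivity), ← ENNReal.ofReal_mul (by positivity)]
      congr 1
      push_cast
      rw [Real.mul_rpow (hmp j).le (hMp j).le, Real.rpow_sub_one (hMp j).ne']
      field_simp
    rw [e]
    refine ENNReal.ofReal_le_ofReal ?_
    have h1 : (m j : ℝ) ^ p ≤ (L : ℝ) ^ p :=
      Real.rpow_le_rpow (hmp j).le (by exact_mod_cast hL j) hp0.le
    have h2 : (M m (b + 1) : ℝ) ^ (1 - p) ≤ (L : ℝ) ^ (1 - p) * (M m b : ℝ) ^ (1 - p) := by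
      rw [← Real.mul_rpow hLp.le (hMp b).le]
      refine Real.rpow_le_rpow (hMp _).le ?_ (by linarith)
      rw [M_succ]
      push_cast
      have : (m b : ℝ) ≤ L := by exact_mod_cast hL b
      gcongr
    have h3 : (M m j : ℝ) ^ (p - 1) ≤ (M m a : ℝ) ^ (p - 1) * r ^ (j - a) := by
      have h4 := M_mul_two_pow_le hm a (j - a)
      rw [Nat.add_sub_cancel' hj.1] at h4
      have h4' : (M m a : ℝ) * 2 ^ (j - a) ≤ M m j := by exact_mod_cast h4
      refine (Real.rpow_le_rpow_of_nonpos (by have := hMp a; positivity) h4'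
        (by linarith)).trans_eq ?_
      rw [Real.mul_rpow (hMp a).le (by positivity), hr, ← Real.rpow_natCast, ← Real.rpow_natCast,
        ← Real.rpow_mul (by norm_num), ← Real.rpow_mul (by norm_num), mul_comm (p - 1)]
    have h5 : (L : ℝ) = (L : ℝ) ^ p * (L : ℝ) ^ (1 - p) := by
      rw [← Real.rpow_add hLp]; simp
    calc (m j : ℝ) ^ p * (M m (b + 1) : ℝ) ^ (1 - p) * (M m j : ℝ) ^ (p - 1)
        ≤ (L : ℝ) ^ p * ((L : ℝ) ^ (1 - p) * (M m b : ℝ) ^ (1 - p)) *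
            ((M m a : ℝ) ^ (p - 1) * r ^ (j - a)) := by gcongr
      _ = _ := by
        rw [Real.div_rpow (hMp b).le (hMp a).le, ← neg_sub 1 p, Real.rpow_neg (hMp a).le]
        conv_rhs => rw [h5]
        ring
  refine (Finset.sum_le_sum hterm).trans ?_
  rw [← ENNReal.ofReal_sum_of_nonneg fun j _ => by
    have := hMp a; have := hMp b; positivity]
  refine ENNReal.ofReal_le_ofReal ?_
  rw [← Finset.mul_sum, Finset.sum_Ico_eq_sum_range]
  simp only [Nat.add_sub_cancel_left]
  have hs : ∑ i ∈ Finset.range (b + 1 - a), r ^ i ≤ (1 - r)⁻¹ := by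
    rw [← tsum_geometric_of_lt_one hr0.le hr1]
    exact (summable_geometric_of_lt_one hr0.le hr1).sum_le_tsum _ fun _ _ => by positivity
  have hX : 0 ≤ ((M m b : ℝ) / M m a) ^ (1 - p) := by
    have := hMp a; have := hMp b; positivity
  calc L * ((M m b : ℝ) / M m a) ^ (1 - p) * ∑ i ∈ Finset.range (b + 1 - a), r ^ i
      ≤ L * ((M m b : ℝ) / M m a) ^ (1 - p) * (1 - r)⁻¹ := by gcongr
    _ = _ := by ring

theorem HpNorm_partialSum_le {p : ℝ} (hp0 : 0 < p) (hp1 : p < 1) {m : ℕ → ℕ}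
    (hm : ∀ k, 2 ≤ m k) {L : ℕ} (hL : ∀ k, m k ≤ L) {f : ℕ → Group m → ℂ}
    (hf : Martingale f (filtration m hm) (haar m)) (n : ℕ) :
    HpNorm m p (toMartingale m (partialSum m n f)) ≤
      ENNReal.ofReal ((1 + L / (1 - 2 ^ (p - 1))) ^ (1 / p) * ratio m p n) * HpNorm m p f := by
  have := isProbabilityMeasure_haar hm
  have hMp : ∀ k, (0 : ℝ) < M m k := fun k => by exact_mod_cast M_pos hm k
  set a := low m n with ha
  set b := high m n with hb
  have hab : a ≤ b := low_le_high hm n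
  set C : ℝ := L / (1 - 2 ^ (p - 1)) with hC
  have hr1 : (2 : ℝ) ^ (p - 1) < 1 := Real.rpow_lt_one_of_one_lt_of_neg one_lt_two (by linarith)
  have hC0 : 0 ≤ C := div_nonneg (by positivity) (by linarith)
  set q : ℝ := (M m b : ℝ) / M m a with hq
  have hq1 : 1 ≤ q := by
    rw [hq, one_le_div (hMp a)]
    exact_mod_cast M_mono hm hab
  have hnM : n ≤ M m (b + 1) := (lt_M_high_succ hm n).le
  set X := ∫⁻ x, (⨆ k, ‖f k x‖ₑ) ^ p ∂haar m with hX
  have hS : ∫⁻ x, ‖partialSum m n f x‖ₑ ^ p ∂haar m ≤ ENNReal.ofReal (C * q ^ (1 - p)) * X := by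
    rw [partialSum_eq hf hnM]
    refine (lintegral_partialSumFun_le hm hp0 hp1 n (hf.stronglyMeasurable _)
      (hf.integrable _)).trans ?_
    refine mul_le_mul' (geom_weight_sum_le hm hL hp0 hp1 a b) (lintegral_mono fun x => ?_)
    exact ENNReal.rpow_le_rpow (le_iSup (fun k => ‖f k x‖ₑ) _) hp0.le
  have hSm : Measurable fun x => ‖partialSum m n f x‖ₑ ^ p := by
    refine Measurable.pow_const (Measurable.enorm ?_) p
    exact Finset.measurable_sum _ fun i _ => (measurable_psi hm i).const_mul _
  -- `S_{M_k} S_n f = S_{min(M_k, n)} f` is `f_k` when `M_k ≤ n` and `S_n f` otherwise.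
  have hsup : ∀ x, (⨆ k, ‖toMartingale m (partialSum m n f) k x‖ₑ) ≤
      (⨆ k, ‖f k x‖ₑ) + ‖partialSum m n f x‖ₑ := by
    refine fun x => iSup_le fun k => ?_
    rw [toMartingale, partialSumFun_partialSum hm]
    rcases le_total (M m k) n with h | h
    · rw [min_eq_left h, partialSum_M hf]
      exact (le_iSup (fun k => ‖f k x‖ₑ) k).trans le_self_add
    · rw [min_eq_right h]
      exact le_add_self
  have hmain : ∫⁻ x, (⨆ k, ‖toMartingale m (partialSum m n f) k x‖ₑ) ^ p ∂haar m ≤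
      ENNReal.ofReal ((1 + C) * q ^ (1 - p)) * X := by
    calc _ ≤ ∫⁻ x, ((⨆ k, ‖f k x‖ₑ) ^ p + ‖partialSum m n f x‖ₑ ^ p) ∂haar m :=
          lintegral_mono fun x => (ENNReal.rpow_le_rpow (hsup x) hp0.le).trans
            (ENNReal.rpow_add_le_add_rpow _ _ hp0.le hp1.le)
      _ ≤ X + ENNReal.ofReal (C * q ^ (1 - p)) * X := by
          rw [lintegral_add_right _ hSm]
          gcongr
      _ = ENNReal.ofReal (1 + C * q ^ (1 - p)) * X := by
          rw [ENNReal.ofReal_add zero_le_one (by positivity), ENNReal.ofReal_one, add_mul, one_mul]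
      _ ≤ _ := by
          gcongr
          -- The summand `1` coming from the maximal function of `f` is absorbed because `q^{1-p} ≥
          -- 1`.
          have := Real.one_le_rpow hq1 (by linarith : (0 : ℝ) ≤ 1 - p)
          nlinarith
  calc HpNorm m p (toMartingale m (partialSum m n f))
      ≤ (ENNReal.ofReal ((1 + C) * q ^ (1 - p)) * X) ^ (1 / p) :=
        ENNReal.rpow_le_rpow hmain (by positivity)
    _ = _ := by
        rw [ENNReal.mul_rpow_of_nonneg _ _ (by positivity), HpNorm,
          ENNReal.ofReal_rpow_of_nonneg (by positivity) (by positivity),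
          Real.mul_rpow (by positivity) (by positivity), ← Real.rpow_mul (by positivity), ratio]
        congr 4
        field_simp

/-! ### Lacunary martingales -/

theorem rademacher_zero (m : ℕ → ℕ) (k : ℕ) : rademacher m k 0 = 1 := by
  simp [rademacher]

theorem psi_apply_zero (m : ℕ → ℕ) (n : ℕ) : psi m n 0 = 1 := by
  simp [psi, rademacher_zero]

theorem kernel_apply_zero (m : ℕ → ℕ) (n : ℕ) (x : Group m) :
    kernel m n x 0 = ∑ i ∈ Finset.range n, psi m i x := by
  simp [kernel, psi_apply_zero]

theorem kernel_M_zero {m : ℕ → ℕ} (hm : ∀ k, 2 ≤ m k) (k : ℕ) (x : Group m) :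
    kernel m (M m k) x 0 = (I m k 0).indicator (fun _ => (M m k : ℂ)) x := by
  rw [kernel_M hm]
  by_cases h : x ∈ I m k 0
  · rw [Set.indicator_of_mem h, Set.indicator_of_mem (mem_I_comm.1 h)]
  · rw [Set.indicator_of_notMem h, Set.indicator_of_notMem fun h' => h (mem_I_comm.1 h')]

/-- The martingale `∑_{b<n} c_b (D_{M_{b+1}} - D_{M_b})`. -/
noncomputable def lacunary (m : ℕ → ℕ) (c : ℕ → ℝ) (n : ℕ) (x : Group m) : ℂ :=
  ∑ b ∈ Finset.range n, (c b : ℂ) * (kernel m (M m (b + 1)) x 0 - kernel m (M m b) x 0)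

theorem lacunary_succ (m : ℕ → ℕ) (c : ℕ → ℝ) (n : ℕ) (x : Group m) :
    lacunary m c (n + 1) x = lacunary m c n x +
      (c n : ℂ) * (kernel m (M m (n + 1)) x 0 - kernel m (M m n) x 0) :=
  Finset.sum_range_succ _ _

theorem stronglyMeasurable_kernel_M {m : ℕ → ℕ} (hm : ∀ k, 2 ≤ m k) {k n : ℕ} (hkn : k ≤ n) :
    StronglyMeasurable[filtration m hm n] fun x => kernel m (M m k) x 0 := by
  simp_rw [kernel_M_zero hm]
  exact stronglyMeasurable_const.indicator (I_measurableSet_filtration hm hkn 0)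

theorem stronglyMeasurable_lacunary {m : ℕ → ℕ} (hm : ∀ k, 2 ≤ m k) (c : ℕ → ℝ) (n : ℕ) :
    StronglyMeasurable[filtration m hm n] (lacunary m c n) := by
  refine Finset.stronglyMeasurable_fun_sum _ fun b hb => ?_
  have hb := Finset.mem_range.1 hb
  exact ((stronglyMeasurable_kernel_M hm (k := b + 1) hb).sub
    (stronglyMeasurable_kernel_M hm hb.le)).const_mul _

theorem integrable_kernel {m : ℕ → ℕ} (hm : ∀ k, 2 ≤ m k) (n : ℕ) :
    Integrable (fun x => kernel m n x 0) (haar m) := by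
  simp_rw [kernel_apply_zero]
  exact integrable_finsetSum _ fun i _ => integrable_psi hm i

theorem integrable_lacunary {m : ℕ → ℕ} (hm : ∀ k, 2 ≤ m k) (c : ℕ → ℝ) (n : ℕ) :
    Integrable (lacunary m c n) (haar m) :=
  integrable_finsetSum _ fun _ _ =>
    ((integrable_kernel hm _).sub (integrable_kernel hm _)).const_mul _

-- `D_{M_k}` is the normalized indicator of `I_k(0)`, which lies inside or outside `s` as a whole.
-- The value does not depend on `k ≥ i`, so the increments of `lacunary` have zero integral over
-- `s`; this is the martingale property.
open Classical in
theorem setIntegral_kernel_M {m : ℕ → ℕ} (hm : ∀ k, 2 ≤ m k) {i k : ℕ} (hik : i ≤ k)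
    {s : Set (Group m)} (hs : MeasurableSet[filtration m hm i] s) :
    ∫ x in s, kernel m (M m k) x 0 ∂haar m = if (0 : Group m) ∈ s then 1 else 0 := by
  have h0 : (M m k : ℂ) ≠ 0 := by exact_mod_cast (M_pos hm k).ne'
  have hmem : ∀ x ∈ I m k 0, x ∈ s ↔ (0 : Group m) ∈ s := fun x hx =>
    mem_iff_of_measurableSet_filtration hm hs fun j hj => hx j (hj.trans_le hik)
  simp_rw [kernel_M_zero hm]
  rw [setIntegral_indicator (measurableSet_I m k 0), setIntegral_const, measureReal_def]
  split_ifs with h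
  · have : s ∩ I m k 0 = I m k 0 := Set.inter_eq_right.2 fun x hx => (hmem x hx).2 h
    rw [this, haar_I hm]
    simp [h0]
  · have : s ∩ I m k 0 = ∅ :=
      Set.eq_empty_of_forall_notMem fun x hx => h ((hmem x hx.2).1 hx.1)
    simp [this]

theorem martingale_lacunary {m : ℕ → ℕ} (hm : ∀ k, 2 ≤ m k) (c : ℕ → ℝ) :
    Martingale (lacunary m c) (filtration m hm) (haar m) := by
  have := isProbabilityMeasure_haar hm
  refine martingale_of_setIntegral_eq_succ (stronglyMeasurable_lacunary hm c)
    (integrable_lacunary hm c) fun i s hs => ?_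
  simp_rw [lacunary_succ]
  have h1 := (integrable_kernel hm (M m (i + 1))).integrableOn (s := s)
  have h2 := (integrable_kernel hm (M m i)).integrableOn (s := s)
  have h3 : IntegrableOn (fun x => (c i : ℂ) *
      (kernel m (M m (i + 1)) x 0 - kernel m (M m i) x 0)) s (haar m) := (h1.sub h2).const_mul _
  rw [integral_add (integrable_lacunary hm c i).integrableOn h3,
    integral_const_mul, integral_sub h1 h2, setIntegral_kernel_M hm (Nat.le_succ i) hs,
    setIntegral_kernel_M hm le_rfl hs, sub_self, mul_zero, add_zero]

theorem lintegral_kernel_M_rpow {m : ℕ → ℕ} (hm : ∀ k, 2 ≤ m k) {p : ℝ} (hp0 : 0 < p) (k : ℕ) :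
    ∫⁻ x, ‖kernel m (M m k) x 0‖ₑ ^ p ∂haar m = ENNReal.ofReal ((M m k : ℝ) ^ (p - 1)) := by
  have hM : (0 : ℝ) < M m k := by exact_mod_cast M_pos hm k
  have h : ∀ x, ‖kernel m (M m k) x 0‖ₑ ^ p =
      (I m k 0).indicator (fun _ => (M m k : ℝ≥0∞) ^ p) x := fun x => by
    rw [kernel_M_zero hm]
    by_cases hx : x ∈ I m k 0
    · rw [Set.indicator_of_mem hx, Set.indicator_of_mem hx, ← ofReal_norm, Complex.norm_natCast,
        ENNReal.ofReal_natCast]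
    · rw [Set.indicator_of_notMem hx, Set.indicator_of_notMem hx, enorm_zero,
        ENNReal.zero_rpow_of_pos hp0]
  simp_rw [h]
  rw [lintegral_indicator (measurableSet_I m k 0), setLIntegral_const, haar_I hm,
    ← ENNReal.ofReal_natCast, ENNReal.ofReal_rpow_of_pos hM, ← ENNReal.ofReal_inv_of_pos hM,
    ← ENNReal.ofReal_mul (by positivity), Real.rpow_sub_one hM.ne', div_eq_mul_inv]

theorem measurable_kernel {m : ℕ → ℕ} (hm : ∀ k, 2 ≤ m k) (n : ℕ) :
    Measurable fun x => kernel m n x 0 := by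
  simp_rw [kernel_apply_zero]
  exact Finset.measurable_sum _ fun i _ => measurable_psi hm i

theorem HpNorm_lacunary_lt_top {m : ℕ → ℕ} (hm : ∀ k, 2 ≤ m k) {p : ℝ} (hp0 : 0 < p)
    (hp1 : p < 1) {c : ℕ → ℝ} (hc : ∀ b, 0 ≤ c b)
    (hs : Summable fun b => c b ^ p * (M m b : ℝ) ^ (p - 1)) :
    HpNorm m p (lacunary m c) < ∞ := by
  set u : ℕ → Group m → ℝ≥0∞ := fun b x => ENNReal.ofReal (c b ^ p) *
    (‖kernel m (M m (b + 1)) x 0‖ₑ ^ p + ‖kernel m (M m b) x 0‖ₑ ^ p) with hu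
  have hmeas : ∀ k, Measurable fun x => ‖kernel m (M m k) x 0‖ₑ ^ p := fun k =>
    (measurable_kernel hm _).enorm.pow_const p
  have hpt : ∀ x, (⨆ n, ‖lacunary m c n x‖ₑ) ^ p ≤ ∑' b, u b x := fun x => by
    -- The exponent is moved across so that the supremum can be bounded one `n` at a time.
    rw [← ENNReal.le_rpow_inv_iff hp0]
    refine iSup_le fun n => ?_
    rw [ENNReal.le_rpow_inv_iff hp0]
    calc ‖lacunary m c n x‖ₑ ^ p
        ≤ (∑ b ∈ Finset.range n, ‖(c b : ℂ) *
            (kernel m (M m (b + 1)) x 0 - kernel m (M m b) x 0)‖ₑ) ^ p :=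
          ENNReal.rpow_le_rpow (enorm_sum_le _ _) hp0.le
      _ ≤ ∑ b ∈ Finset.range n, ‖(c b : ℂ) *
            (kernel m (M m (b + 1)) x 0 - kernel m (M m b) x 0)‖ₑ ^ p :=
          rpow_sum_le_sum_rpow _ _ hp0 hp1.le
      _ ≤ ∑ b ∈ Finset.range n, u b x := by
          refine Finset.sum_le_sum fun b _ => ?_
          have hcb : ‖(c b : ℂ)‖ₑ ^ p = ENNReal.ofReal (c b ^ p) := by
            rw [← ofReal_norm, Complex.norm_real, Real.norm_of_nonneg (hc b),
              ENNReal.ofReal_rpow_of_nonneg (hc b) hp0.le]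
          rw [enorm_mul, ENNReal.mul_rpow_of_nonneg _ _ hp0.le, hcb]
          refine mul_le_mul_right ?_ _
          exact (ENNReal.rpow_le_rpow (enorm_sub_le) hp0.le).trans
            (ENNReal.rpow_add_le_add_rpow _ _ hp0.le hp1.le)
      _ ≤ ∑' b, u b x := ENNReal.sum_le_tsum _
  have hint : ∀ b, ∫⁻ x, u b x ∂haar m ≤
      ENNReal.ofReal (2 * (c b ^ p * (M m b : ℝ) ^ (p - 1))) := fun b => by
    have hM : (0 : ℝ) < M m b := by exact_mod_cast M_pos hm b
    have hadd : Measurable fun x =>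
      ‖kernel m (M m (b + 1)) x 0‖ₑ ^ p + ‖kernel m (M m b) x 0‖ₑ ^ p := (hmeas _).add (hmeas _)
    rw [hu, lintegral_const_mul _ hadd, lintegral_add_left (hmeas _),
      lintegral_kernel_M_rpow hm hp0, lintegral_kernel_M_rpow hm hp0,
      ← ENNReal.ofReal_add (by positivity) (by positivity),
      ← ENNReal.ofReal_mul (Real.rpow_nonneg (hc b) p)]
    refine ENNReal.ofReal_le_ofReal ?_
    -- `M_b^{p-1}` decreases in `b`, so the two kernels of one increment together cost the factor
    -- `2`.
    have h1 : (M m (b + 1) : ℝ) ^ (p - 1) ≤ (M m b : ℝ) ^ (p - 1) :=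
      Real.rpow_le_rpow_of_nonpos hM (by exact_mod_cast M_mono hm (Nat.le_succ b)) (by linarith)
    have h2 := Real.rpow_nonneg (hc b) p
    nlinarith [mul_le_mul_of_nonneg_left h1 h2]
  refine ENNReal.rpow_lt_top_of_nonneg (by positivity) (ne_of_lt ?_)
  calc ∫⁻ x, (⨆ n, ‖lacunary m c n x‖ₑ) ^ p ∂haar m
      ≤ ∫⁻ x, ∑' b, u b x ∂haar m := lintegral_mono hpt
    _ = ∑' b, ∫⁻ x, u b x ∂haar m :=
        lintegral_tsum fun b => (((hmeas _).add (hmeas _)).const_mul _).aemeasurable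
    _ ≤ ∑' b, ENNReal.ofReal (2 * (c b ^ p * (M m b : ℝ) ^ (p - 1))) :=
        ENNReal.tsum_le_tsum hint
    _ < ∞ := (hs.mul_left 2).tsum_ofReal_lt_top

/-- All coefficients with index in `[M_b, M_{b+1})` equal `c_b`, so in that range the partial sum
adds `c_b` times a difference of Dirichlet kernels. -/
theorem partialSum_lacunary {m : ℕ → ℕ} (hm : ∀ k, 2 ≤ m k) (c : ℕ → ℝ) {n b : ℕ}
    (hn : M m b ≤ n) (hn' : n ≤ M m (b + 1)) (x : Group m) :
    partialSum m n (lacunary m c) x =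
      lacunary m c b x + (c b : ℂ) * (kernel m n x 0 - kernel m (M m b) x 0) := by
  have hf := martingale_lacunary hm c
  -- Candidate coefficients; they represent the level `b + 1` of the martingale, so by uniqueness
  -- they are its coefficients below `M_{b+1}`.
  set a : ℕ → ℂ := fun i => if i < M m b then coeff m (lacunary m c) i else c b with ha
  have hsum : ∀ l, M m b ≤ l → ∀ y, ∑ i ∈ Finset.range l, a i * psi m i y =
      lacunary m c b y + (c b : ℂ) * (kernel m l y 0 - kernel m (M m b) y 0) := by
    intro l hl y
    rw [← Finset.sum_range_add_sum_Ico _ hl, kernel_apply_zero, kernel_apply_zero,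
      ← Finset.sum_Ico_eq_sub _ hl, Finset.mul_sum]
    congr 1
    · rw [← partialSum_M hf b, partialSum]
      exact Finset.sum_congr rfl fun i hi => by rw [ha]; simp only [if_pos (Finset.mem_range.1 hi)]
    · exact Finset.sum_congr rfl fun i hi => by
        rw [ha]; simp only [if_neg (not_lt.2 (Finset.mem_Ico.1 hi).1)]
  have hcoeff : ∀ i < M m (b + 1), coeff m (lacunary m c) i = a i := fun i hi => by
    refine coeff_unique hm (n := M m (b + 1)) (fun y => ?_) hi
    rw [hsum _ (M_mono hm (Nat.le_succ b)), ← lacunary_succ, ← partialSum_M hf (b + 1)]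
    rfl
  rw [← hsum n hn, partialSum]
  exact Finset.sum_congr rfl fun i hi => by
    rw [hcoeff i ((Finset.mem_range.1 hi).trans_le hn')]

/-! ### Lower estimates -/

/-- Both `πd/M` and its reflection `π - πd/M` are at least `π/M`, and one of them lies in the range
where sine increases. -/
theorem sin_pi_div_le {M d : ℕ} (hd : 1 ≤ d) (hdM : d < M) :
    Real.sin (Real.pi / M) ≤ Real.sin (Real.pi * d / M) := by
  have hM : (0 : ℝ) < M := by exact_mod_cast (by omega : 0 < M)
  have hpi := Real.pi_pos
  have hd' : (1 : ℝ) ≤ d := by exact_mod_cast hd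
  have hdM' : (d : ℝ) + 1 ≤ M := by exact_mod_cast hdM
  have h0 : 0 < Real.pi / M := by positivity
  have h1 : Real.pi / M ≤ Real.pi * d / M := by
    gcongr
    nlinarith
  have h2 : Real.pi / M ≤ Real.pi - Real.pi * d / M := by
    rw [le_sub_iff_add_le, ← add_div, div_le_iff₀ hM]
    nlinarith
  rcases le_total (Real.pi * d / M) (Real.pi / 2) with h | h
  · exact Real.sin_le_sin_of_le_of_le_pi_div_two (by linarith) h h1
  · rw [← Real.sin_pi_sub (Real.pi * d / M)]
    exact Real.sin_le_sin_of_le_of_le_pi_div_two (by linarith) (by linarith) h2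

/-- The geometric sum has modulus `sin(πd/m_k) / sin(π/m_k)`. The choice `x_k = 1` matters: for
other nonzero `x_k` the sum may vanish. -/
theorem one_le_norm_sum_rademacherRatio {m : ℕ → ℕ} (hm : ∀ k, 2 ≤ m k) {k d : ℕ} (hd : 1 ≤ d)
    (hdm : d < m k) {x : Group m} (hx : x k = 1) :
    1 ≤ ‖∑ s ∈ Finset.range d, rademacherRatio m k x 0 ^ s‖ := by
  have hk : Fact (1 < m k) := ⟨hm k⟩
  have hM : (0 : ℝ) < m k := by exact_mod_cast (by omega : 0 < m k)
  set ω := rademacherRatio m k x 0 with hω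
  have hωe : ∀ d : ℕ, ω ^ d = Complex.exp (Complex.I * ((2 * (Real.pi * d / m k) : ℝ) : ℂ)) := by
    intro d
    rw [hω, rademacherRatio, rademacher_zero, map_one, mul_one, rademacher, hx, ZMod.val_one,
      ← Complex.exp_nat_mul]
    congr 1
    push_cast
    ring
  have hnorm : ∀ d : ℕ, ‖ω ^ d - 1‖ = 2 * |Real.sin (Real.pi * d / m k)| := fun d => by
    rw [hωe, Complex.norm_exp_I_mul_ofReal_sub_one]
    simp
  have hne : ω ≠ 1 := by
    rw [hω, Ne, rademacherRatio_eq_one_iff hm, hx]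
    exact one_ne_zero
  have h1 : 0 < ‖ω - 1‖ := norm_pos_iff.2 (sub_ne_zero.2 hne)
  rw [geom_sum_eq hne, norm_div, one_le_div h1]
  have h2 := hnorm 1
  rw [pow_one, Nat.cast_one, mul_one] at h2
  rw [h2, hnorm d]
  have h3 : 0 ≤ Real.sin (Real.pi / m k) := by
    refine Real.sin_nonneg_of_nonneg_of_le_pi (by positivity) ?_
    rw [div_le_iff₀ hM]
    have : (1 : ℝ) ≤ m k := by exact_mod_cast hk.out.le
    nlinarith [Real.pi_pos]
  have h4 := sin_pi_div_le hd hdm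
  rw [abs_of_nonneg h3, abs_of_nonneg (h3.trans h4)]
  linarith

theorem sum_M_rpow_le {m : ℕ → ℕ} (hm : ∀ k, 2 ≤ m k) {r : ℝ} (hr : 1 ≤ r) (a : ℕ) :
    ∑ i ∈ Finset.range (a + 1), (M m i : ℝ) ^ r ≤ 2 * (M m a : ℝ) ^ r := by
  induction a with
  | zero => simp [M]
  | succ a ih =>
    rw [Finset.sum_range_succ]
    have h1 : (2 : ℝ) * (M m a : ℝ) ^ r ≤ (M m (a + 1) : ℝ) ^ r := by
      have h2 : (2 : ℝ) * M m a ≤ M m (a + 1) := by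
        rw [M_succ]; exact_mod_cast Nat.mul_le_mul_right _ (hm a)
      calc (2 : ℝ) * (M m a : ℝ) ^ r ≤ 2 ^ r * (M m a : ℝ) ^ r := by
            gcongr
            exact Real.self_le_rpow_of_one_le one_le_two hr
        _ = (2 * (M m a : ℝ)) ^ r := by rw [Real.mul_rpow (by norm_num) (by positivity)]
        _ ≤ _ := Real.rpow_le_rpow (by positivity) h2 (by linarith)
    linarith

/-- Since `x_a ≠ 0`, the kernels `D_{M_k}` with `k > a` vanish at `x`, and only increments with `i ≤
a` survive. They are of size `L M_i^{1/p}`, whose sum is at most twice its last term, so the bound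
does not depend on `b`. -/
theorem norm_lacunary_le {m : ℕ → ℕ} (hm : ∀ k, 2 ≤ m k) {L : ℕ} (hL : ∀ k, m k ≤ L) {p : ℝ}
    (hp0 : 0 < p) (hp1 : p < 1) {c : ℕ → ℝ} (hc : ∀ b, 0 ≤ c b)
    (hc' : ∀ b, c b ≤ (M m b : ℝ) ^ (1 / p - 1)) {a b : ℕ} (hab : a < b) {x : Group m}
    (hx : x a ≠ 0) : ‖lacunary m c b x‖ ≤ 2 * L * (M m a : ℝ) ^ (1 / p) := by
  have hMp : ∀ k, (0 : ℝ) < M m k := fun k => by exact_mod_cast M_pos hm k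
  have hzero : ∀ k, a < k → kernel m (M m k) x 0 = 0 := fun k hk => by
    rw [kernel_M_zero hm, Set.indicator_of_notMem fun h : x ∈ I m k 0 => hx (h a hk)]
  have hk : ∀ k, 0 ≤ (kernel m (M m k) x 0).re ∧ (kernel m (M m k) x 0).re ≤ M m k ∧
      kernel m (M m k) x 0 = ((kernel m (M m k) x 0).re : ℂ) := fun k => by
    rw [kernel_M_zero hm]
    by_cases h : x ∈ I m k 0
    · simp [Set.indicator_of_mem h]
    · simp [Set.indicator_of_notMem h]
  have hterm : ∀ i, ‖(c i : ℂ) * (kernel m (M m (i + 1)) x 0 - kernel m (M m i) x 0)‖ ≤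
      L * (M m i : ℝ) ^ (1 / p) := fun i => by
    have h1 : ‖kernel m (M m (i + 1)) x 0 - kernel m (M m i) x 0‖ ≤ M m (i + 1) := by
      rw [(hk (i + 1)).2.2, (hk i).2.2, ← Complex.ofReal_sub, Complex.norm_real, Real.norm_eq_abs,
        abs_le]
      have h2 : (M m i : ℝ) ≤ M m (i + 1) := by exact_mod_cast M_mono hm (Nat.le_succ i)
      constructor <;> linarith [(hk i).1, (hk i).2.1, (hk (i + 1)).1, (hk (i + 1)).2.1]
    have h3 : (M m (i + 1) : ℝ) ≤ L * M m i := by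
      rw [M_succ]; exact_mod_cast Nat.mul_le_mul_right _ (hL i)
    rw [norm_mul, Complex.norm_real, Real.norm_of_nonneg (hc i)]
    calc c i * ‖kernel m (M m (i + 1)) x 0 - kernel m (M m i) x 0‖
        ≤ (M m i : ℝ) ^ (1 / p - 1) * (L * M m i) :=
          mul_le_mul (hc' i) (h1.trans h3) (norm_nonneg _) (by positivity)
      _ = _ := by
          rw [Real.rpow_sub_one (hMp i).ne']
          have := (hMp i).ne'
          field_simp
  have hsub : lacunary m c b x = ∑ i ∈ Finset.range (a + 1),
      (c i : ℂ) * (kernel m (M m (i + 1)) x 0 - kernel m (M m i) x 0) := by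
    refine (Finset.sum_subset (Finset.range_mono hab) fun i _ hi => ?_).symm
    rw [Finset.mem_range, not_lt] at hi
    rw [hzero _ (by omega), hzero _ (by omega), sub_zero, mul_zero]
  rw [hsub]
  refine (norm_sum_le_of_le _ fun i _ => hterm i).trans ?_
  rw [← Finset.mul_sum]
  have := sum_M_rpow_le hm (r := 1 / p) ((one_le_div hp0).2 hp1.le) a
  calc _ ≤ (L : ℝ) * (2 * (M m a : ℝ) ^ (1 / p)) := by gcongr
    _ = _ := by ring

theorem le_norm_partialSum_lacunary {m : ℕ → ℕ} (hm : ∀ k, 2 ≤ m k) {L : ℕ}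
    (hL : ∀ k, m k ≤ L) {p : ℝ} (hp0 : 0 < p) (hp1 : p < 1) {w : ℕ → ℝ} (hw : ∀ b, 0 ≤ w b)
    (hw' : ∀ b, w b ≤ 1) {n : ℕ} (hn : 1 ≤ n) (hlow : low m n < high m n) {x : Group m}
    (hx : x ∈ I m (low m n + 1) (Pi.single (low m n) 1)) :
    (M m (low m n) : ℝ) ^ (1 / p) * (w (high m n) * ratio m p n - 2 * L) ≤
      ‖partialSum m n (lacunary m fun b => w b * (M m b : ℝ) ^ (1 / p - 1)) x‖ := by
  have hMp : ∀ k, (0 : ℝ) < M m k := fun k => by exact_mod_cast M_pos hm k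
  set a := low m n with ha
  set b := high m n with hb
  set c : ℕ → ℝ := fun b => w b * (M m b : ℝ) ^ (1 / p - 1) with hcdef
  have hc : ∀ b, 0 ≤ c b := fun b => mul_nonneg (hw b) (by positivity)
  have hc' : ∀ b, c b ≤ (M m b : ℝ) ^ (1 / p - 1) := fun b =>
    mul_le_of_le_one_left (by positivity) (hw' b)
  have hfact : Fact (1 < m a) := ⟨hm a⟩
  have hxa : x a = 1 := by simpa using hx a (Nat.lt_succ_self a)
  have hxa0 : x a ≠ 0 := by rw [hxa]; exact one_ne_zero
  have hxI : (0 : Group m) ∈ I m a x := fun j hj => by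
    rw [hx j (by omega), Pi.single_eq_of_ne hj.ne, Pi.zero_apply]
  -- On this coset `D_n` reduces to the block of the lowest digit, which has modulus at least `M_a`.
  have hker : (M m a : ℝ) ≤ ‖kernel m n x 0‖ := by
    rw [norm_kernel_eq hm n hxI hxa0, ← ha]
    exact le_mul_of_one_le_right (hMp a).le (one_le_norm_sum_rademacherRatio hm
      (Nat.one_le_iff_ne_zero.2 (digit_low_ne_zero hm hn)) (digit_lt hm n a) hxa)
  have hkerM : kernel m (M m b) x 0 = 0 := by
    rw [kernel_M_zero hm, Set.indicator_of_notMem fun h : x ∈ I m b 0 => hxa0 (h a hlow)]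
  rw [partialSum_lacunary hm c (M_high_le hm hn) (lt_M_high_succ hm n).le, ← hb, hkerM, sub_zero]
  have h1 := norm_lacunary_le hm hL hp0 hp1 hc hc' hlow hxa0
  have h2 : (c b : ℝ) * M m a ≤ ‖(c b : ℂ) * kernel m n x 0‖ := by
    rw [norm_mul, Complex.norm_real, Real.norm_of_nonneg (hc b)]
    exact mul_le_mul_of_nonneg_left hker (hc b)
  have h3 : (c b : ℝ) * M m a = (M m a : ℝ) ^ (1 / p) * (w b * ratio m p n) := by
    rw [hcdef, ratio, ← ha, ← hb, Real.div_rpow (hMp b).le (hMp a).le,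
      Real.rpow_sub_one (hMp a).ne']
    have h4 := (hMp a).ne'
    have h5 : (M m a : ℝ) ^ (1 / p) ≠ 0 := (Real.rpow_pos_of_pos (hMp a) _).ne'
    field_simp
  have h4 := norm_sub_le_norm_add ((c b : ℂ) * kernel m n x 0) (lacunary m c b x)
  rw [add_comm] at h4
  rw [mul_sub, ← h3]
  linarith

theorem le_weakNorm_partialSum_lacunary {m : ℕ → ℕ} (hm : ∀ k, 2 ≤ m k) {L : ℕ}
    (hL : ∀ k, m k ≤ L) {p : ℝ} (hp0 : 0 < p) (hp1 : p < 1) {w : ℕ → ℝ} (hw : ∀ b, 0 ≤ w b)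
    (hw' : ∀ b, w b ≤ 1) {n : ℕ} (hn : 1 ≤ n) (hlow : low m n < high m n) {φ : ℝ} (hφ : 0 < φ) :
    ENNReal.ofReal ((w (high m n) * ratio m p n - 2 * L) / (2 * φ) * (L : ℝ)⁻¹ ^ (1 / p)) ≤
      weakNorm m p fun x =>
        partialSum m n (lacunary m fun b => w b * (M m b : ℝ) ^ (1 / p - 1)) x / (φ : ℂ) := by
  have hMp : ∀ k, (0 : ℝ) < M m k := fun k => by exact_mod_cast M_pos hm k
  have hL0 : (0 : ℝ) < L := by
    have := (hm 0).trans (hL 0)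
    exact_mod_cast (by omega : 0 < L)
  set a := low m n with ha
  set R := w (high m n) * ratio m p n - 2 * L with hR
  rcases le_or_gt R 0 with hR0 | hR0
  · rw [ENNReal.ofReal_of_nonpos]
    · exact zero_le
    · exact mul_nonpos_of_nonpos_of_nonneg (div_nonpos_of_nonpos_of_nonneg hR0 (by positivity))
        (by positivity)
  -- Half of the pointwise lower bound, because the weak norm uses the strict inequality `t < ‖g
  -- x‖`.
  set t : ℝ := (M m a : ℝ) ^ (1 / p) * R / (2 * φ) with ht
  have hMa : 0 < (M m a : ℝ) ^ (1 / p) := Real.rpow_pos_of_pos (hMp a) _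
  have ht0 : 0 < t := by positivity
  refine le_trans ?_ (le_iSup₂_of_le t ht0 le_rfl)
  have hsub : I m (a + 1) (Pi.single a 1) ⊆ {x | t < ‖partialSum m n
      (lacunary m fun b => w b * (M m b : ℝ) ^ (1 / p - 1)) x / (φ : ℂ)‖} := by
    intro x hx
    have h := le_norm_partialSum_lacunary hm hL hp0 hp1 hw hw' hn hlow hx
    rw [Set.mem_ofPred_eq, norm_div, Complex.norm_real, Real.norm_of_nonneg hφ.le]
    refine lt_of_lt_of_le ?_ (div_le_div_of_nonneg_right h hφ.le)
    rw [ht, div_lt_div_iff₀ (by positivity) hφ]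
    have : 0 < (M m a : ℝ) ^ (1 / p) * R * φ := by positivity
    nlinarith
  calc ENNReal.ofReal (R / (2 * φ) * (L : ℝ)⁻¹ ^ (1 / p))
      = ENNReal.ofReal t * ENNReal.ofReal ((L * M m a : ℝ)⁻¹) ^ (1 / p) := by
        rw [ENNReal.ofReal_rpow_of_pos (by have := hMp a; positivity),
          ← ENNReal.ofReal_mul ht0.le, mul_inv, Real.mul_rpow (by positivity) (by positivity),
          Real.inv_rpow (hMp a).le, ht]
        congr 1
        field_simp
    _ ≤ ENNReal.ofReal t * haar m (I m (a + 1) (Pi.single a 1)) ^ (1 / p) := by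
        rw [haar_I hm, ← ENNReal.ofReal_natCast, ← ENNReal.ofReal_inv_of_pos (hMp _)]
        gcongr
        · exact hMp _
        · rw [M_succ]; exact_mod_cast Nat.mul_le_mul_right _ (hL a)
    _ ≤ _ := by gcongr

/-! ### Selection of levels and divergence of the weak norms -/

theorem ratio_nonneg (m : ℕ → ℕ) (p : ℝ) (n : ℕ) : 0 ≤ ratio m p n := by
  rw [ratio]; positivity

theorem ratio_le_one {m : ℕ → ℕ} (hm : ∀ k, 2 ≤ m k) (p : ℝ) {n : ℕ}
    (h : high m n ≤ low m n) : ratio m p n ≤ 1 := by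
  have h0 : (M m (low m n) : ℝ) ≠ 0 := by exact_mod_cast (M_pos hm _).ne'
  rw [ratio, le_antisymm h (low_le_high hm n), div_self h0, Real.one_rpow]

/-- Divergence of the weak norms for a martingale built on the levels selected from the `limsup`
condition. -/
theorem exists_memHp_iSup_weakNorm_eq_top {p : ℝ} (hp0 : 0 < p) (hp1 : p < 1) {m : ℕ → ℕ}
    (hm : ∀ k, 2 ≤ m k) (hbdd : BddAbove (Set.range m)) {n : ℕ → ℕ} (hn : StrictMono n)
    {Φ : ℕ → ℝ} (hΦ : Monotone Φ)
    (hlim : limsup (fun k => ((ratio m p (n k) / Φ (n k) : ℝ) : EReal)) atTop = ⊤) :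
    ∃ f : ℕ → Group m → ℂ, MemHp m hm p f ∧
      (⨆ k, weakNorm m p fun x => partialSum m (n k) f x / (Φ (n k) : ℂ)) = ∞ := by
  obtain ⟨L, hL⟩ := hbdd
  replace hL : ∀ k, m k ≤ L := fun k => hL ⟨k, rfl⟩
  have hL0 : (0 : ℝ) < L := by
    have := (hm 0).trans (hL 0)
    exact_mod_cast (by omega : 0 < L)
  have hfreq : ∀ C : ℝ, ∃ᶠ k in atTop, C < ratio m p (n k) / Φ (n k) := fun C => by
    have h : ((C : ℝ) : EReal) <
        limsup (fun k => ((ratio m p (n k) / Φ (n k) : ℝ) : EReal)) atTop := by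
      rw [hlim]; exact EReal.coe_lt_top C
    exact (frequently_lt_of_lt_limsup (by isBoundedDefault) h).mono
      fun k hk => EReal.coe_lt_coe_iff.1 hk
  -- A positive quotient forces `Φ (n k₀) > 0`, and monotonicity then keeps `Φ` at or above `ε` from
  -- that index on.
  obtain ⟨k₀, hk₀⟩ := (hfreq 0).exists
  have hε : 0 < Φ (n k₀) := by
    by_contra h
    exact absurd (div_nonpos_of_nonneg_of_nonpos (ratio_nonneg m p _) (not_lt.1 h)) (not_le.2 hk₀)
  set ε := Φ (n k₀) with hεdef
  -- Chosen so that `θ^p = 1/2`, which makes the `p`-th powers of the weights summable.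
  set θ : ℝ := 2⁻¹ ^ (1 / p) with hθ
  have hθ0 : 0 < θ := by positivity
  have hθ1 : θ < 1 := Real.rpow_lt_one (by norm_num) (by norm_num) (by positivity)
  have hsel : ∀ j : ℕ, ∃ᶠ b in atTop, ∃ k, high m (n k) = b ∧ low m (n k) < high m (n k) ∧
      1 ≤ n k ∧ ε ≤ Φ (n k) ∧ j / θ ^ j ≤ ratio m p (n k) / Φ (n k) := by
    intro j
    rw [frequently_atTop]
    intro B
    -- The bound `j / θ^j` compensates the weight `θ^j`. The bound `ε⁻¹` excludes `low = high`,
    -- where the ratio is at most `1`. Finally `k ≥ M_B` gives `n k ≥ M_B`, hence `high m (n k) ≥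
    -- B`.
    obtain ⟨k, hk, hCk⟩ := (frequently_atTop.1 (hfreq (max (j / θ ^ j) ε⁻¹))) (max k₀ (M m B))
    have hkn : M m B ≤ n k := (le_max_right _ _).trans (hk.trans hn.le_apply)
    have hεk : ε ≤ Φ (n k) := hΦ (hn.monotone ((le_max_left _ _).trans hk))
    have hΦk : 0 < Φ (n k) := hε.trans_le hεk
    refine ⟨high m (n k), ?_, k, rfl, ?_, (M_pos hm B).trans_le hkn, hεk,
      (le_max_left _ _).trans hCk.le⟩
    · by_contra h
      have := lt_M_high_succ hm (n k)
      have := M_mono hm (show high m (n k) + 1 ≤ B by omega)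
      omega
    · by_contra h
      have h1 := ratio_le_one hm p (not_lt.1 h)
      have h2 := (le_max_right _ _).trans_lt hCk
      rw [lt_div_iff₀ hΦk] at h2
      have h3 : 1 ≤ ε⁻¹ * Φ (n k) := by
        rw [inv_mul_eq_div]; exact (one_le_div hε).2 hεk
      linarith
  obtain ⟨φ, hφ, hsel⟩ := extraction_forall_of_frequently hsel
  -- The weight is `θ^j` at the `j`-th selected level and `0` at all other levels.
  set w : ℕ → ℝ := Function.extend φ (fun j => θ ^ j) 0 with hw
  have hwφ : ∀ j, w (φ j) = θ ^ j := fun j => hφ.injective.extend_apply _ _ _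
  have hw0 : ∀ b, b ∉ Set.range φ → w b = 0 := fun b hb =>
    Function.extend_apply' _ _ _ fun ⟨j, hj⟩ => hb ⟨j, hj⟩
  have hwb : ∀ b, 0 ≤ w b ∧ w b ≤ 1 := fun b => by
    by_cases hb : b ∈ Set.range φ
    · obtain ⟨j, rfl⟩ := hb
      rw [hwφ]
      exact ⟨by positivity, pow_le_one₀ hθ0.le hθ1.le⟩
    · rw [hw0 b hb]
      exact ⟨le_rfl, zero_le_one⟩
  have hsum : Summable fun b => w b ^ p := by
    have h1 : (fun b => w b ^ p) = Function.extend φ (fun j => ((2 : ℝ)⁻¹) ^ j) 0 := by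
      funext b
      by_cases hb : b ∈ Set.range φ
      · obtain ⟨j, rfl⟩ := hb
        rw [hwφ, hφ.injective.extend_apply, hθ, ← Real.rpow_natCast, ← Real.rpow_natCast,
          ← Real.rpow_mul (by positivity), ← Real.rpow_mul (by positivity)]
        congr 1
        field_simp
      · rw [hw0 b hb, Real.zero_rpow hp0.ne', Function.extend_apply' _ _ _ fun ⟨j, hj⟩ => hb ⟨j, hj⟩]
        rfl
    rw [h1, summable_extend_zero hφ.injective]
    exact summable_geometric_of_lt_one (by norm_num) (by norm_num)
  refine ⟨lacunary m fun b => w b * (M m b : ℝ) ^ (1 / p - 1), ⟨martingale_lacunary hm _,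
    HpNorm_lacunary_lt_top hm hp0 hp1 (fun b => mul_nonneg (hwb b).1 (by positivity)) ?_⟩, ?_⟩
  · refine hsum.congr fun b => ?_
    have hM : (0 : ℝ) < M m b := by exact_mod_cast M_pos hm b
    rw [Real.mul_rpow (hwb b).1 (by positivity), ← Real.rpow_mul hM.le, mul_assoc,
      ← Real.rpow_add hM]
    -- The normalization `M_b^{1/p-1}` exactly cancels `‖D_{M_b}‖_p^p = M_b^{p-1}`, leaving `∑
    -- w_b^p`.
    have : (1 / p - 1) * p + (p - 1) = 0 := by field_simp; ring
    rw [this, Real.rpow_zero, mul_one]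
  · rw [iSup_eq_top]
    intro r hr
    set K : ℝ := (L : ℝ)⁻¹ ^ (1 / p) with hK
    have hK0 : 0 < K := by positivity
    -- The lower bound for the weak norm is at least `K (j/2 - L/ε)`, where `L/ε` dominates the
    -- error from the lower blocks.
    obtain ⟨j, hj⟩ := exists_nat_gt (2 * (r.toReal / K + L / ε))
    obtain ⟨k, hkb, hlow, hnk, hεk, hrat⟩ := hsel j
    have hΦk : 0 < Φ (n k) := hε.trans_le hεk
    refine ⟨k, lt_of_lt_of_le ?_ (le_weakNorm_partialSum_lacunary hm hL hp0 hp1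
      (fun b => (hwb b).1) (fun b => (hwb b).2) hnk hlow hΦk)⟩
    rw [← ENNReal.ofReal_toReal hr.ne, ENNReal.ofReal_lt_ofReal_iff_of_nonneg ENNReal.toReal_nonneg,
      ← div_lt_iff₀ hK0, hkb, hwφ]
    have h1 : (j : ℝ) ≤ θ ^ j * ratio m p (n k) / Φ (n k) := by
      rw [div_le_iff₀ (by positivity)] at hrat
      calc (j : ℝ) ≤ _ := hrat
        _ = _ := by ring
    have h2 : L / Φ (n k) ≤ L / ε := by gcongr
    have h3 : (θ ^ j * ratio m p (n k) - 2 * L) / (2 * Φ (n k)) =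
        θ ^ j * ratio m p (n k) / Φ (n k) / 2 - L / Φ (n k) := by
      field_simp
    rw [h3]
    linarith

end Vilenkin

theorem mainTheorem1 (p : ℝ) (hp0 : 0 < p) (hp1 : p < 1) :
    (∀ L : ℕ, ∃ c : ℝ, 0 < c ∧
      ∀ (m : ℕ → ℕ) (hm : ∀ k, 2 ≤ m k), (∀ k, m k ≤ L) →
        ∀ f : ℕ → Vilenkin.Group m → ℂ, Vilenkin.MemHp m hm p f →
          ∀ n : ℕ, 1 ≤ n →
            Vilenkin.HpNorm m p (Vilenkin.toMartingale m (Vilenkin.partialSum m n f)) ≤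
              ENNReal.ofReal (c * Vilenkin.ratio m p n) * Vilenkin.HpNorm m p f) ∧
    (∀ (m : ℕ → ℕ) (hm : ∀ k, 2 ≤ m k), BddAbove (Set.range m) →
      ∀ n : ℕ → ℕ, StrictMono n →
        (⨆ k, (Vilenkin.rho m (n k) : ℕ∞)) = ⊤ →
        ∀ Φ : ℕ → ℝ, Monotone Φ →
          limsup (fun k => ((Vilenkin.ratio m p (n k) / Φ (n k) : ℝ) : EReal)) atTop = ⊤ →
          ∃ f : ℕ → Vilenkin.Group m → ℂ, Vilenkin.MemHp m hm p f ∧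
            (⨆ k, Vilenkin.weakNorm m p
              fun x => Vilenkin.partialSum m (n k) f x / (Φ (n k) : ℂ)) = ∞) := by
  constructor
  · intro L
    have hr1 : (2 : ℝ) ^ (p - 1) < 1 :=
      Real.rpow_lt_one_of_one_lt_of_neg one_lt_two (by linarith)
    have hC : (0 : ℝ) ≤ L / (1 - 2 ^ (p - 1)) := div_nonneg (by positivity) (by linarith)
    exact ⟨(1 + L / (1 - 2 ^ (p - 1))) ^ (1 / p), by positivity,
      fun m hm hL f hf n _ => Vilenkin.HpNorm_partialSum_le hp0 hp1 hm hL hf.1 n⟩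
  · intro m hm hbdd n hn _ Φ hΦ hlim
    exact Vilenkin.exists_memHp_iSup_weakNorm_eq_top hp0 hp1 hm hbdd hn hΦ hlim
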